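/- Theorem (Halmos–Mirman). All Hilbert spaces are complex. For $1\le n\le\aleph_0$ let $\ell^2(n)$ be the Hilbert space of dimension $n$. For an operator system $\mathcal R$ (a unital selfadjoint linear subspace of a unital C*-algebra), let $S_n(\mathcal R)$ be the set of unital completely positive (ucp) linear maps $\mathcal R\to B(\ell^2(n))$ and $S_{\rm nc}(\mathcal R)=\bigsqcup_{1\le n\le\aleph_0}S_n(\mathcal R)$. For a tuple $\mathfrak x=(x_1,\dots,x_d)$ in a unital C*-algebra, let $\mathcal O_{\mathfrak x}=\mathrm{Span}\{1,x_1,x_1^*,\dots,x_d,x_d^*\}$, $W_n(\mathfrak x)=\{(\phi(x_1),\dots,\phi(x_d)) : \phi\in S_n(\mathcal O_{\mathfrak x})\}$ and $W_{\rm nc}(\mathfrak x)=\bigsqcup_{1\le n\le\aleph_0}W_n(\mathfrak x)$. For $K\subseteq\mathbb R^d$ compact and convex, let $K^{\max}=\bigsqcup_{1\le n\le\aleph_0}K_n^{\max}$, where $K^{\max}_n$ is the set of $d$-tuples $\mathfrak a$ of selfadjoint operators on $\ell^2(n)$ with $W_1(\mathfrak a)\subseteq K$. Let $C_k\subset\mathbb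 C$ be the set of $k$-th roots of unity, $P(3)=\mathrm{Conv}\,C_3\times\mathrm{Conv}\,C_2\subset\mathbb C\times\mathbb R=\mathbb R^3$, and regard $P(3)^{\max}$ as a graded set of pairs of operators by identifying a selfadjoint triple $(a,b,c)$ with the pair $(a+ib,c)$. Let $C^*(\mathbb Z_3*\mathbb Z_2)$ be the full group C*-algebra of the free product, $w$ and $v$ its canonical unitaries given by the generators of $\mathbb Z_3$ and $\mathbb Z_2$ (so $w^3=v^2=1$), and $\mathrm{NCP}(3)=\mathrm{Span}\{1,w,w^2,v\}\subseteq C^*(\mathbb Z_3*\mathbb Z_2)$. Then: 1. $P(3)^{\max}_n=W_n(w,v)$ for every $1\le n\le\aleph_0$, that is, $P(3)^{\max}=W_{\rm nc}(w,v)$. 2. $W_{\rm nc}(w,v)\cong S_{\rm nc}(\mathrm{NCP}(3))$ in the category of compact noncommutative convex sets: both graded sets are closed under direct sums $\sum_i\alpha_i x_i\alpha_i^*$ of countable bounded families ($\alpha_i$ isometries with $\sum_i\alpha_i\alpha_i^*=1$, sums in the strong operator topology) and under compressions $\beta^*x\beta$ by isometries, have compact levels in the topology of entrywise (pointwise on $\mathrm{NCP}(3)$)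 weak operator convergence, and there are level-wise bijections between them which, together with their inverses, are continuous at each level, respect such direct sums, and are equivariant under isometries. 3. For every Hilbert space $\mathcal H$ and all $x,y\in B(\mathcal H)$: the numerical range $\{\langle x\xi,\xi\rangle:\|\xi\|=1\}$ of $x$ lies in $\mathrm{Conv}\,C_3$ and $y$ is a selfadjoint contraction if and only if there is a ucp map $\phi:C^*(\mathbb Z_3*\mathbb Z_2)\to B(\mathcal H)$ with $\phi(w)=x$ and $\phi(v)=y$. -/

import Mathlib

noncomputable section

open scoped ComplexOrder InnerProductSpace ENNReal

universe u v w

namespace NCPrism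

/-! ### Operator systems and ucp maps -/

/-- A (concrete) operator system: a unital, selfadjoint linear subspace of a unital
C*-algebra. -/
structure OperatorSystem (A : Type u) [CStarAlgebra A] extends
    Submodule ℂ A where
  one_mem' : (1 : A) ∈ carrier
  star_mem' : ∀ {a : A}, a ∈ carrier → star a ∈ carrier

section OperatorSystem

variable {A : Type u} [CStarAlgebra A]

/-- The order unit of an operator system. -/
def OperatorSystem.unit (S : OperatorSystem A) : S.toSubmodule := ⟨1, S.one_mem'⟩

/-- The whole algebra, as an operator system in itself. -/
def OperatorSystem.whole (A : Type u) [CStarAlgebra A] :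
    OperatorSystem A where
  toSubmodule := ⊤
  one_mem' := Submodule.mem_top
  star_mem' _ := Submodule.mem_top

/-- The operator system spanned by `1` and the entries of a tuple `x`, together with their
adjoints. -/
def opSysOf {d : ℕ} (x : Fin d → A) : OperatorSystem A where
  toSubmodule := Submodule.span ℂ
    ({1} ∪ (Set.range x ∪ Set.range fun j => star (x j)))
  one_mem' := Submodule.subset_span (Or.inl rfl)
  star_mem' := by
    intro a ha
    change a ∈ Submodule.span ℂ _ at ha
    change star a ∈ Submodule.span ℂ _
    induction ha using Submodule.span_induction with
    | mem y hy =>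
      apply Submodule.subset_span
      rcases hy with hy | ⟨j, rfl⟩ | ⟨j, rfl⟩
      · left; simp [Set.mem_singleton_iff.1 hy]
      · exact Or.inr (Or.inr ⟨j, rfl⟩)
      · exact Or.inr (Or.inl ⟨j, by simp⟩)
    | zero => simp
    | add y z _ _ hy hz => rw [star_add]; exact Submodule.add_mem _ hy hz
    | smul c y _ hy => rw [star_smul]; exact Submodule.smul_mem _ _ hy

theorem mem_opSysOf {d : ℕ} (x : Fin d → A) (j : Fin d) :
    x j ∈ (opSysOf x).toSubmodule :=
  Submodule.subset_span (Or.inr (Or.inl ⟨j, rfl⟩))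

/-- The positive cone of `M_k(S)`: the matrices with entries in `S` that are positive in the
C*-algebra `M_k(A)`, that is, of the form `B* B`. -/
def OperatorSystem.MatPos (S : OperatorSystem A) {k : ℕ}
    (M : Matrix (Fin k) (Fin k) S.toSubmodule) : Prop :=
  ∃ B : Matrix (Fin k) (Fin k) A, M.map (fun s => (s : A)) = B.conjTranspose * B

/-- A `k × k` matrix of bounded operators on `H` is positive: as an operator on the direct sum
`H ⊕ ⋯ ⊕ H` of `k` copies of `H` it satisfies `⟪ξ, T ξ⟫ ≥ 0` for every `ξ`. -/
def OpMatPos {H : Type v} [NormedAddCommGroup H] [InnerProductSpace ℂ H] {k : ℕ}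
    (T : Matrix (Fin k) (Fin k) (H →L[ℂ] H)) : Prop :=
  ∀ ξ : Fin k → H, 0 ≤ ∑ i, ∑ j, ⟪ξ i, T i j (ξ j)⟫_ℂ

/-- Unital completely positive linear maps from an operator system into `B(H)`. -/
structure IsUCP (S : OperatorSystem A) {H : Type v} [NormedAddCommGroup H]
    [InnerProductSpace ℂ H] (φ : S.toSubmodule →ₗ[ℂ] (H →L[ℂ] H)) : Prop where
  map_unit : φ S.unit = 1
  completelyPositive : ∀ (k : ℕ) (M : Matrix (Fin k) (Fin k) S.toSubmodule),
    S.MatPos M → OpMatPos (M.map φ)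

end OperatorSystem

/-! ### The levels and graded sets -/

/-- The cardinals `n` with `1 ≤ n ≤ ℵ₀`. -/
abbrev Level : Type := {n : ℕ∞ // 1 ≤ n}

/-- The Hilbert space `ℓ²(n)`, with canonical orthonormal basis indexed by `{k : ℕ | k < n}`. -/
abbrev Hilb (n : Level) : Type := lp (fun _ : {k : ℕ // (k : ℕ∞) < n.1} => ℂ) 2

/-- The bounded operators on `ℓ²(n)`. -/
abbrev Op (n : Level) : Type := Hilb n →L[ℂ] Hilb n

/-- A graded set whose `n`-th level consists of families, indexed by `J`, of bounded operators
on `ℓ²(n)`. For `J = Fin d` these are `d`-tuples; for `J` an operator system the families are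
functions from that operator system to `B(ℓ²(n))`. -/
abbrev GradedSet (J : Type u) : Type u := ∀ n : Level, Set (J → Op n)

/-- The noncommutative state space of an operator system: its `n`-th level consists of the ucp
maps into `B(ℓ²(n))`. -/
def ncStateSpace {A : Type u} [CStarAlgebra A] (S : OperatorSystem A) :
    GradedSet S.toSubmodule :=
  fun n => {f | ∃ φ : S.toSubmodule →ₗ[ℂ] Op n, IsUCP S φ ∧ f = φ}

/-- The noncommutative numerical range of a tuple. -/
def ncRange {A : Type u} [CStarAlgebra A] {d : ℕ}
    (x : Fin d → A) : GradedSet (Fin d) :=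
  fun n => {a | ∃ φ : (opSysOf x).toSubmodule →ₗ[ℂ] Op n,
    IsUCP (opSysOf x) φ ∧ ∀ j, a j = φ ⟨x j, mem_opSysOf x j⟩}

/-- The first level of the noncommutative numerical range, as a set of points of `ℂ^d` (through
the identification of `B(ℓ²(1))` with `ℂ`). -/
def rangeOne {A : Type u} [CStarAlgebra A] {d : ℕ}
    (x : Fin d → A) : Set (Fin d → ℂ) :=
  {z | (fun j => z j • (1 : Op ⟨1, le_rfl⟩)) ∈ ncRange x ⟨1, le_rfl⟩}

/-- The maximal noncommutative convex set generated by `K ⊆ ℝ^d`: the `d`-tuples of selfadjoint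
operators whose first-level numerical range is contained in `K`. -/
def ncMax {d : ℕ} (K : Set (Fin d → ℝ)) : GradedSet (Fin d) :=
  fun _ => {a | (∀ j, IsSelfAdjoint (a j)) ∧
    rangeOne a ⊆ (fun (p : Fin d → ℝ) (j : Fin d) => (p j : ℂ)) '' K}

/-! ### The category of (compact) noncommutative convex sets -/

section NCConv

variable {J : Type u} {J' : Type v}

/-- The topology on the `n`-th level of a graded set: entrywise convergence in the weak operator
topology. On norm bounded sets this is the point-weak* (point-ultraweak) topology. -/
@[reducible] def levelTopology (K : GradedSet J) (n : Level) : TopologicalSpace (K n) :=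
  TopologicalSpace.induced
    (fun (x : K n) (j : J) => (ContinuousLinearMapWOT.ofCLM (x.1 j) : Hilb n →WOT[ℂ] Hilb n))
    inferInstance

/-- `∑ i, V i V i* = 1`, in the strong operator topology. -/
def IsPartition {ι : Type} {m : ι → Level} {n : Level}
    (V : ∀ i, Hilb (m i) →ₗᵢ[ℂ] Hilb n) : Prop :=
  ∀ ξ : Hilb n, HasSum
    (fun i => V i (ContinuousLinearMap.adjoint (V i).toContinuousLinearMap ξ)) ξ

/-- `y = ∑ i, V i (x i) (V i)*`, entrywise, in the strong operator topology. -/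
def IsNCSum {ι : Type} {m : ι → Level} {n : Level} (V : ∀ i, Hilb (m i) →ₗᵢ[ℂ] Hilb n)
    (x : ∀ i, J → Op (m i)) (y : J → Op n) : Prop :=
  ∀ (j : J) (ξ : Hilb n), HasSum
    (fun i => V i (x i j (ContinuousLinearMap.adjoint (V i).toContinuousLinearMap ξ))) (y j ξ)

/-- The compression `V* x V` of a family `x` by an isometry `V`. -/
def compress {m n : Level} (V : Hilb n →ₗᵢ[ℂ] Hilb m) (x : J → Op m) : J → Op n :=
  fun j => ContinuousLinearMap.adjoint V.toContinuousLinearMap ∘L x j ∘L V.toContinuousLinearMap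

/-- Compact noncommutative convex sets: graded sets closed under (countable) direct sums of
bounded families and under compressions to subspaces, all of whose levels are compact. -/
structure IsCompactNCConvex (K : GradedSet J) : Prop where
  directSum : ∀ {ι : Type} [Countable ι] {m : ι → Level} {n : Level}
    (V : ∀ i, Hilb (m i) →ₗᵢ[ℂ] Hilb n) (x : ∀ i, J → Op (m i)),
    IsPartition V → (∀ i, x i ∈ K (m i)) → (∀ j, ∃ C : ℝ, ∀ i, ‖x i j‖ ≤ C) →
    ∃ y ∈ K n, IsNCSum V x y
  compression : ∀ {m n : Level} (V : Hilb n →ₗᵢ[ℂ] Hilb m) (x : J → Op m),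
    x ∈ K m → compress V x ∈ K n
  compact : ∀ n : Level, @CompactSpace (K n) (levelTopology K n)

/-- Continuous affine noncommutative maps: graded maps that are continuous at each level,
respect direct sums of bounded families, and are equivariant with respect to isometries (in
particular with respect to unitaries). -/
structure IsNCAffine {K : GradedSet J} {L : GradedSet J'} (θ : ∀ n, K n → L n) : Prop where
  map_directSum : ∀ {ι : Type} [Countable ι] {m : ι → Level} {n : Level}
    (V : ∀ i, Hilb (m i) →ₗᵢ[ℂ] Hilb n) (x : ∀ i, K (m i)) (y : K n),
    IsPartition V → (∀ j, ∃ C : ℝ, ∀ i, ‖(x i).1 j‖ ≤ C) →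
    IsNCSum V (fun i => (x i).1) y.1 →
    IsNCSum V (fun i => (θ (m i) (x i)).1) (θ n y).1
  map_compression : ∀ {m n : Level} (V : Hilb n →ₗᵢ[ℂ] Hilb m) (x : K m) (y : K n),
    y.1 = compress V x.1 → (θ n y).1 = compress V (θ m x).1
  continuous : ∀ n : Level, @Continuous _ _ (levelTopology K n) (levelTopology L n) (θ n)

/-- Isomorphism in the category of compact noncommutative convex sets and continuous affine
noncommutative maps. -/
def NCConvIso (K : GradedSet J) (L : GradedSet J') : Prop :=
  IsCompactNCConvex K ∧ IsCompactNCConvex L ∧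
    ∃ θ : ∀ n, K n ≃ L n, IsNCAffine (fun n => θ n) ∧ IsNCAffine (fun n => (θ n).symm)

end NCConv

/-! ### The full group C*-algebra of a discrete group -/

/-- A unitary representation of a discrete group on a nonzero complex Hilbert space. -/
structure UnitaryRep (G : Type u) [Group G] : Type (u + 1) where
  space : Type u
  [normed : NormedAddCommGroup space]
  [inner : InnerProductSpace ℂ space]
  [complete : CompleteSpace space]
  [nontrivial : Nontrivial space]
  hom : G →* unitary (space →L[ℂ] space)

attribute [instance] UnitaryRep.normed UnitaryRep.inner UnitaryRep.complete UnitaryRep.nontrivial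

section GroupCStar

variable (G : Type u) [Group G]

/-- The C*-algebra of bounded families `(T_π)`, `T_π ∈ B(H_π)`, indexed by all unitary
representations `π` of `G`, with the supremum norm. -/
abbrev RepProduct : Type (u + 1) :=
  lp (fun π : UnitaryRep G => π.space →L[ℂ] π.space) ∞

instance : CStarAlgebra (RepProduct G) where

variable {G} in
/-- The value of the universal representation at a group element: the family `(π(g))_π`. -/
def universalRep (g : G) : RepProduct G :=
  ⟨fun π => (π.hom g : π.space →L[ℂ] π.space), memℓp_infty ⟨1, by
    rintro _ ⟨π, rfl⟩
    exact CStarRing.norm_of_mem_unitary (π.hom g).2 |>.le⟩⟩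

/-- The full group C*-algebra `C*(G)`: the C*-algebra generated by the image of the universal
representation, i.e. the completion of the group algebra in the norm
`‖f‖ = sup_π ‖π(f)‖`, where `π` runs through all unitary representations of `G`. (Every
representation is a direct sum of cyclic ones, and these are unitarily equivalent to
representations on spaces in the universe of `G`, so that such spaces suffice.) -/
def groupCStar : StarSubalgebra ℂ (RepProduct G) :=
  (StarAlgebra.adjoin ℂ (Set.range (universalRep : G → RepProduct G))).topologicalClosure

/-- The full group C*-algebra as a type. -/
def GroupCStar : Type (u + 1) := groupCStar G

instance : CStarAlgebra (GroupCStar G) :=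
  StarSubalgebra.cstarAlgebra (groupCStar G)
    (h_closed := StarSubalgebra.isClosed_topologicalClosure _)

variable {G} in
/-- The canonical unitary of `C*(G)` given by a group element. -/
def canonicalUnitary (g : G) : GroupCStar G :=
  ⟨universalRep g, StarSubalgebra.le_topologicalClosure _
    (StarAlgebra.subset_adjoin ℂ _ ⟨g, rfl⟩)⟩

variable {G}

theorem canonicalUnitary_mul (g h : G) :
    canonicalUnitary (g * h) = canonicalUnitary g * canonicalUnitary h := by
  apply Subtype.ext
  apply Subtype.ext
  funext π
  change ((π.hom (g * h) : unitary _) : π.space →L[ℂ] π.space) = π.hom g * π.hom h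
  rw [map_mul]; rfl

theorem canonicalUnitary_star (g : G) :
    star (canonicalUnitary g) = canonicalUnitary g⁻¹ := by
  apply Subtype.ext
  apply Subtype.ext
  funext π
  change star ((π.hom g : unitary _) : π.space →L[ℂ] π.space) = (π.hom g⁻¹ : unitary _)
  rw [map_inv]; rfl

end GroupCStar

/-! ### The triangular prism -/

/-- The free product `ℤ₃ * ℤ₂`. -/
abbrev FreeProd32 : Type := Monoid.Coprod (Multiplicative (ZMod 3)) (Multiplicative (ZMod 2))

/-- The generator of `ℤ₃` in `ℤ₃ * ℤ₂`. -/
def gen3 : FreeProd32 := Monoid.Coprod.inl (Multiplicative.ofAdd 1)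

/-- The generator of `ℤ₂` in `ℤ₃ * ℤ₂`. -/
def gen2 : FreeProd32 := Monoid.Coprod.inr (Multiplicative.ofAdd 1)

/-- The canonical unitary of order 3 in `C*(ℤ₃ * ℤ₂)`. -/
def canonW : GroupCStar FreeProd32 := canonicalUnitary gen3

/-- The canonical unitary of order 2 in `C*(ℤ₃ * ℤ₂)`. -/
def canonV : GroupCStar FreeProd32 := canonicalUnitary gen2

theorem star_canonW : star canonW = canonW ^ 2 := by
  have h : gen3⁻¹ = gen3 * gen3 := by
    unfold gen3
    rw [← map_mul, ← map_inv]; rfl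
  rw [canonW, canonicalUnitary_star, h, canonicalUnitary_mul, pow_two]

theorem star_canonV : star canonV = canonV := by
  have h : gen2⁻¹ = gen2 := by
    unfold gen2
    rw [← map_inv]; rfl
  rw [canonV, canonicalUnitary_star, h]

/-- The noncommutative triangular prism `NCP(3) = Span {1, w, w², v}`, an operator subsystem of
`C*(ℤ₃ * ℤ₂)`. -/
def ncp3 : OperatorSystem (GroupCStar FreeProd32) where
  toSubmodule := Submodule.span ℂ {1, canonW, canonW ^ 2, canonV}
  one_mem' := Submodule.subset_span (by simp)
  star_mem' := by
    intro a ha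
    change a ∈ Submodule.span ℂ _ at ha
    change star a ∈ Submodule.span ℂ _
    induction ha using Submodule.span_induction with
    | mem y hy =>
      apply Submodule.subset_span
      rcases hy with rfl | rfl | rfl | rfl
      · simp
      · simp [star_canonW]
      · simp [← star_canonW]
      · simp [star_canonV]
    | zero => simp
    | add y z _ _ hy hz => rw [star_add]; exact Submodule.add_mem _ hy hz
    | smul c y _ hy => rw [star_smul]; exact Submodule.smul_mem _ _ hy

/-- The convex hull in `ℂ` of the `k`-th roots of unity. -/
def convRoots (k : ℕ) : Set ℂ := convexHull ℝ {z : ℂ | z ^ k = 1}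

/-- The classical triangular prism `P(3) = Conv C₃ × Conv C₂ ⊆ ℝ² × ℝ = ℝ³`. -/
def prism3 : Set (Fin 3 → ℝ) :=
  {p | (⟨p 0, p 1⟩ : ℂ) ∈ convRoots 3 ∧ (p 2 : ℂ) ∈ convRoots 2}

/-- The identification of triples `(a, b, c)` of selfadjoint operators with pairs
`(a + i b, c)`. -/
def toPair {n : Level} (a : Fin 3 → Op n) : Fin 2 → Op n :=
  ![a 0 + Complex.I • a 1, a 2]

/-- The noncommutative convex set `P(3)^max`, viewed as a graded set of pairs of operators. -/
def prism3Max : GradedSet (Fin 2) := fun n => toPair '' ncMax prism3 n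

/-- The (classical, spatial) numerical range of a bounded operator. -/
def numRange {H : Type v} [NormedAddCommGroup H] [InnerProductSpace ℂ H] (x : H →L[ℂ] H) :
    Set ℂ :=
  {z | ∃ ξ : H, ‖ξ‖ = 1 ∧ z = ⟪ξ, x ξ⟫_ℂ}

end NCPrism

end

/-!
The proof rests on one description of the pairs of operators involved. Call `(x, y)` a prism pair
(`IsPrismPair`) if `(⟪ξ, x ξ⟫, ⟪ξ, y ξ⟫)` lies in `‖ξ‖² • (Conv C₃ × Conv C₂)` for every vector `ξ`.
Since `Conv C₃` is a triangle, it is cut out by the three inequalities `1 + 2 Re (c z) ≥ 0`,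
`c ^ 3 = 1`, whose slacks are, up to the factor `1 / 3`, the barycentric coordinates. In this form
the condition says that the operators `1 + c x + c̄ x*` and `1 ± y` are positive.

Each positive operator in question comes from a projection in `C*(ℤ₃ * ℤ₂)`, namely
`(1 + c w + c̄ w²) / 3` or `(1 ± v) / 2`. Hence every ucp map defined on an operator system that
contains `w` and `v` sends `(w, v)` to a prism pair (`IsUCP.isPrismPair`).

Conversely (`IsPrismPair.exists_isUCP`), the barycentric coordinates of `x` and those of `y` are
positive operators `P k` with sum one, and `x`, `y` are their combinations with roots of unity as
coefficients. Such combinations dilate to a direct sum of four copies of the space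
(`exists_dilation`): with `V` the isometry built from the square roots of the `P k` and `J` the
embedding of the original space, the selfadjoint unitary that interchanges the ranges of `V` and `J`
conjugates diagonal operators into the required dilations. So `x` and `y`
dilate, along the same embedding, to unitaries of orders three and two, which give a unitary
representation of the free product. It extends to `C*(ℤ₃ * ℤ₂)` (`exists_extension`), and its
compression is ucp. The norm of `C*(G)` refers to representations in the lowest universe only; since
the group is countable, every vector lies in a separable invariant subspace, which has a copy there.

The equality with `P(3)^max` follows from vector states in one direction and from positivity of
states in the other. For the isomorphism with the state space, a ucp map on `NCP(3)` is determined
by its values at `w` and `v`, as `w²` goes to the adjoint of the image of `w`. Direct sums,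
compressions and weak operator limits of prism pairs are prism pairs because the defining
inequalities are linear, and the operations on pairs and on ucp maps correspond to each other on the
four spanning elements `1`, `w`, `w²`, `v`, the adjoint being harmless for bounded direct sums
(`IsPartition.hasSum_adjoint`) and weak operator continuous.
-/

noncomputable section

open scoped ComplexOrder InnerProductSpace ENNReal

universe u v w

namespace NCPrism

/-! ### Triangles and segments in the plane -/

/-- The primitive cube root of unity `exp (2πi/3)`, in Cartesian coordinates. -/
def omega : ℂ := ⟨-1 / 2, √3 / 2⟩

theorem omega_re : omega.re = -1 / 2 := rfl

theorem omega_im : omega.im = √3 / 2 := rfl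

theorem omega_mul_self : omega * omega = star omega := by
  have h : √3 * √3 = 3 := Real.mul_self_sqrt (by norm_num)
  apply Complex.ext
  · simp [omega_re, omega_im]; nlinarith
  · simp [omega_re, omega_im]; ring

theorem omega_mul_star : omega * star omega = 1 := by
  have h : √3 * √3 = 3 := Real.mul_self_sqrt (by norm_num)
  apply Complex.ext
  · simp [omega_re, omega_im]; nlinarith
  · simp [omega_re, omega_im, mul_comm]

theorem omega_add_star : omega + star omega = -1 := by
  apply Complex.ext
  · simp [omega_re]
  · simp [omega_im]

theorem omega_pow_three : omega ^ 3 = 1 := by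
  rw [pow_succ, pow_two, omega_mul_self, mul_comm, omega_mul_star]

theorem star_omega_pow_three : star omega ^ 3 = 1 := by
  rw [← star_pow, omega_pow_three, star_one]

theorem pow_three_eq_one_iff {c : ℂ} : c ^ 3 = 1 ↔ c = 1 ∨ c = omega ∨ c = star omega := by
  constructor
  · intro h
    have h' : (c - 1) * ((c - omega) * (c - star omega)) = 0 := by
      have : (c - 1) * ((c - omega) * (c - star omega)) =
          (c - 1) * (c ^ 2 - c * (omega + star omega) + omega * star omega) := by ring
      rw [this, omega_add_star, omega_mul_star]
      linear_combination h
    rcases mul_eq_zero.1 h' with h | h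
    · exact Or.inl (sub_eq_zero.1 h)
    rcases mul_eq_zero.1 h with h | h
    · exact Or.inr (Or.inl (sub_eq_zero.1 h))
    · exact Or.inr (Or.inr (sub_eq_zero.1 h))
  · rintro (rfl | rfl | rfl)
    exacts [one_pow _, omega_pow_three, star_omega_pow_three]

theorem forall_pow_three_eq_one {P : ℂ → Prop} :
    (∀ c : ℂ, c ^ 3 = 1 → P c) ↔ P 1 ∧ P omega ∧ P (star omega) := by
  simp only [pow_three_eq_one_iff]
  constructor
  · intro h
    exact ⟨h _ (by simp), h _ (by simp), h _ (by simp)⟩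
  · rintro ⟨h₁, h₂, h₃⟩ c (rfl | rfl | rfl) <;> assumption

/-- The triangle `Conv C₃` is the intersection of three half planes. The slacks of the three
inequalities, divided by three, are the barycentric coordinates. -/
theorem mem_convRoots_three {z : ℂ} :
    z ∈ convRoots 3 ↔ ∀ c : ℂ, c ^ 3 = 1 → 0 ≤ 1 + 2 * (c * z).re := by
  constructor
  · intro hz c hc
    have hconv : Convex ℝ {z : ℂ | 0 ≤ 1 + 2 * (c * z).re} := by
      intro a ha b hb s t hs ht hst
      simp only [Set.mem_ofPred_eq, Complex.mul_re, Complex.add_re, Complex.add_im,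
        Complex.real_smul, Complex.mul_im, Complex.ofReal_re, Complex.ofReal_im, zero_mul,
        sub_zero, add_zero] at ha hb ⊢
      nlinarith [mul_nonneg hs ha, mul_nonneg ht hb]
    refine convexHull_min ?_ hconv hz
    intro u hu
    have h3 : (c * u) ^ 3 = 1 := by rw [mul_pow, hc, hu, one_mul]
    change 0 ≤ 1 + 2 * (c * u).re
    rcases pow_three_eq_one_iff.1 h3 with h | h | h <;> rw [h] <;> simp [omega_re] <;> norm_num
  · intro h
    obtain ⟨h₁, h₂, h₃⟩ := forall_pow_three_eq_one.1 h
    have hz : z = ((1 + 2 * (1 * z).re) / 3) • (1 : ℂ) +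
        ((1 + 2 * (star omega * z).re) / 3) • omega +
        ((1 + 2 * (omega * z).re) / 3) • star omega := by
      have h : √3 * √3 = 3 := Real.mul_self_sqrt (by norm_num)
      apply Complex.ext
      · simp [omega_re, omega_im]; ring
      · simp [omega_re, omega_im]; linear_combination (-z.im / 3) * h
    rw [hz]
    have hc := convex_convexHull ℝ {z : ℂ | z ^ 3 = 1}
    have := hc.sum_mem (t := Finset.univ) (w := ![(1 + 2 * (1 * z).re) / 3,
      (1 + 2 * (star omega * z).re) / 3, (1 + 2 * (omega * z).re) / 3])
      (z := ![1, omega, star omega]) ?_ ?_ ?_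
    · change _ ∈ (convexHull ℝ) {z : ℂ | z ^ 3 = 1}
      simpa only [Fin.sum_univ_three, Matrix.cons_val] using this
    · intro i _
      fin_cases i
      · change 0 ≤ (1 + 2 * (1 * z).re) / 3; positivity
      · change 0 ≤ (1 + 2 * (star omega * z).re) / 3; positivity
      · change 0 ≤ (1 + 2 * (omega * z).re) / 3; positivity
    · simp [Fin.sum_univ_three, omega_re, omega_im]; ring
    · intro i _
      apply subset_convexHull
      fin_cases i
      · exact one_pow _
      · exact omega_pow_three
      · exact star_omega_pow_three

theorem mem_convRoots_two {z : ℂ} : z ∈ convRoots 2 ↔ z.im = 0 ∧ |z.re| ≤ 1 := by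
  constructor
  · intro hz
    have hconv : Convex ℝ {z : ℂ | z.im = 0 ∧ |z.re| ≤ 1} := by
      intro a ha b hb s t hs ht hst
      simp only [Set.mem_ofPred_eq, Complex.add_re, Complex.add_im,
        Complex.real_smul, Complex.mul_re, Complex.mul_im, Complex.ofReal_re, Complex.ofReal_im,
        zero_mul, sub_zero, add_zero, abs_le] at ha hb ⊢
      refine ⟨by simp [ha.1, hb.1], ?_, ?_⟩
      · nlinarith [ha.2.1, hb.2.1]
      · nlinarith [ha.2.2, hb.2.2]
    refine convexHull_min ?_ hconv hz
    intro u hu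
    rcases (sq_eq_sq_iff_eq_or_eq_neg.1 (hu.trans (one_pow 2).symm)) with h | h <;> rw [h] <;> simp
  · rintro ⟨h₁, h₂⟩
    rw [abs_le] at h₂
    have hz : z = ((1 + z.re) / 2) • (1 : ℂ) + ((1 - z.re) / 2) • (-1 : ℂ) := by
      apply Complex.ext
      · simp; ring
      · simp [h₁]
    rw [hz]
    refine convex_convexHull ℝ {z : ℂ | z ^ 2 = 1} (subset_convexHull _ _ ?_)
      (subset_convexHull _ _ ?_) (by linarith) (by linarith) (by ring) <;> simp

/-- If the numbers `t + c q + c̄ q'`, for the three cube roots `c` of unity, are all nonnegative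
(in particular real), then `q'` is the conjugate of `q`. -/
theorem eq_star_of_nonneg {t : ℝ} {q q' : ℂ}
    (h : ∀ c : ℂ, c ^ 3 = 1 → 0 ≤ (t : ℂ) + c * q + star c * q') :
    q' = star q ∧ ∀ c : ℂ, c ^ 3 = 1 → 0 ≤ t + 2 * (c * q).re := by
  have hq : q' = star q := by
    obtain ⟨h₁, h₂, -⟩ := forall_pow_three_eq_one.1 h
    have e₁ := (Complex.nonneg_iff.1 h₁).2
    have e₂ := (Complex.nonneg_iff.1 h₂).2
    simp [omega_re, omega_im] at e₁ e₂
    have h3 : √3 ≠ 0 := by positivity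
    apply Complex.ext
    · simp
      apply mul_left_cancel₀ h3
      linarith
    · simp; linarith
  refine ⟨hq, fun c hc => ?_⟩
  have := (Complex.nonneg_iff.1 (h c hc)).1
  subst hq
  simp at this ⊢
  linarith

/-! ### Ucp maps and positivity -/

section UCP

variable {A : Type u} [CStarAlgebra A] {H : Type v} [NormedAddCommGroup H] [InnerProductSpace ℂ H]

theorem IsUCP.inner_nonneg {S : OperatorSystem A} {φ : S.toSubmodule →ₗ[ℂ] (H →L[ℂ] H)}
    (hφ : IsUCP S φ) {s : S.toSubmodule} {b : A} (hs : (s : A) = star b * b) (ξ : H) :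
    0 ≤ ⟪ξ, φ s ξ⟫_ℂ := by
  have := hφ.completelyPositive 1 (.of fun _ _ => s) ⟨.of fun _ _ => b, by
    ext i j
    simp [Matrix.mul_apply, hs]⟩ (fun _ => ξ)
  simpa [Matrix.map_apply] using this

/-- The restriction of a ucp map to a smaller operator system is ucp. -/
theorem IsUCP.restrict {S T : OperatorSystem A} {φ : T.toSubmodule →ₗ[ℂ] (H →L[ℂ] H)}
    (hφ : IsUCP T φ) (hST : S.toSubmodule ≤ T.toSubmodule) :
    IsUCP S (φ ∘ₗ Submodule.inclusion hST) where
  map_unit := hφ.map_unit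
  completelyPositive k M := by
    rintro ⟨B, hB⟩
    exact hφ.completelyPositive k (M.map (Submodule.inclusion hST)) ⟨B, by rw [← hB]; rfl⟩

/-- The compression `V* ρ(·) V` of a `*`-representation `ρ` by an isometry `V` is ucp. -/
theorem isUCP_compression {K : Type w} [NormedAddCommGroup K] [InnerProductSpace ℂ K]
    [CompleteSpace K] [CompleteSpace H] (S : OperatorSystem A) (ρ : A →ₗ[ℂ] (K →L[ℂ] K))
    (hone : ρ 1 = 1)
    (hmul : ∀ a b, ρ (star a * b) = ContinuousLinearMap.adjoint (ρ a) ∘L ρ b) (V : H →L[ℂ] K)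
    (hV : ContinuousLinearMap.adjoint V ∘L V = 1) (φ : S.toSubmodule →ₗ[ℂ] (H →L[ℂ] H))
    (hφ : ∀ s : S.toSubmodule, φ s = ContinuousLinearMap.adjoint V ∘L ρ s ∘L V) : IsUCP S φ where
  map_unit := by
    rw [hφ]
    change ContinuousLinearMap.adjoint V ∘L ρ 1 ∘L V = 1
    rw [hone, ← hV]; rfl
  completelyPositive k M := by
    rintro ⟨B, hB⟩ ξ
    have hM : ∀ i j, (M i j : A) = ∑ l, star (B l i) * B l j := fun i j => by
      simpa [Matrix.mul_apply] using congrFun (congrFun hB i) j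
    have key : ∑ i, ∑ j, ⟪ξ i, (M.map φ) i j (ξ j)⟫_ℂ =
        ∑ l, ⟪∑ i, ρ (B l i) (V (ξ i)), ∑ j, ρ (B l j) (V (ξ j))⟫_ℂ := by
      simp only [Matrix.map_apply, hφ, hM, map_sum, hmul, ContinuousLinearMap.comp_apply,
        sum_apply, ContinuousLinearMap.adjoint_inner_right, inner_sum,
        sum_inner]
      rw [Finset.sum_comm_cycle]
      exact Finset.sum_congr rfl fun l _ => Finset.sum_comm
    rw [key]
    exact Finset.sum_nonneg fun l _ => (by
      rw [inner_self_eq_norm_sq_to_K]; positivity)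

end UCP

/-! ### Pairs of operators with numerical range in the prism -/

section PrismPair

variable {H : Type v} [NormedAddCommGroup H] [InnerProductSpace ℂ H]

/-- A pair `(x, y)` of operators is a prism pair if for every vector `ξ` the point
`(⟪ξ, x ξ⟫, ⟪ξ, y ξ⟫)` of `ℂ × ℂ` lies in `‖ξ‖² • (Conv C₃ × Conv C₂)`. The scaled prism is
described by its defining linear inequalities, which pass to sums and limits. -/
def IsPrismPair (x y : H →L[ℂ] H) : Prop :=
  ∀ ξ : H, (∀ c : ℂ, c ^ 3 = 1 → 0 ≤ ‖ξ‖ ^ 2 + 2 * (c * ⟪ξ, x ξ⟫_ℂ).re) ∧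
    (⟪ξ, y ξ⟫_ℂ).im = 0 ∧ |(⟪ξ, y ξ⟫_ℂ).re| ≤ ‖ξ‖ ^ 2

variable {x y : H →L[ℂ] H}

theorem isPrismPair_of_unit (h : ∀ ξ : H, ‖ξ‖ = 1 →
    ⟪ξ, x ξ⟫_ℂ ∈ convRoots 3 ∧ ⟪ξ, y ξ⟫_ℂ ∈ convRoots 2) : IsPrismPair x y := by
  intro ξ
  rcases eq_or_ne ξ 0 with rfl | hξ
  · simp
  have hpos : 0 < ‖ξ‖ := norm_pos_iff.2 hξ
  have h1 : ‖((‖ξ‖⁻¹ : ℝ) : ℂ) • ξ‖ = 1 := by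
    rw [norm_smul]; simp [hpos.ne']
  have hin : ∀ T : H →L[ℂ] H, ⟪ξ, T ξ⟫_ℂ = ((‖ξ‖ ^ 2 : ℝ) : ℂ) *
      ⟪((‖ξ‖⁻¹ : ℝ) : ℂ) • ξ, T (((‖ξ‖⁻¹ : ℝ) : ℂ) • ξ)⟫_ℂ := fun T => by
    have : (‖ξ‖ : ℂ) ≠ 0 := Complex.ofReal_ne_zero.2 hpos.ne'
    rw [map_smul, inner_smul_left, inner_smul_right, Complex.conj_ofReal]
    push_cast
    field_simp
  obtain ⟨hx, hy⟩ := h _ h1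
  rw [mem_convRoots_two] at hy
  rw [hin x, hin y, Complex.re_ofReal_mul, Complex.im_ofReal_mul, hy.1, mul_zero, abs_mul,
    abs_of_nonneg (sq_nonneg ‖ξ‖)]
  refine ⟨fun c hc => ?_, rfl, mul_le_of_le_one_right (sq_nonneg _) hy.2⟩
  rw [mul_left_comm, Complex.re_ofReal_mul]
  nlinarith [mul_nonneg (sq_nonneg ‖ξ‖) (mem_convRoots_three.1 hx c hc)]

theorem isPrismPair_iff_numRange [CompleteSpace H] :
    IsPrismPair x y ↔ numRange x ⊆ convRoots 3 ∧ IsSelfAdjoint y ∧ ‖y‖ ≤ 1 := by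
  constructor
  · intro h
    have hsym : (y : H →ₗ[ℂ] H).IsSymmetric := by
      rw [LinearMap.isSymmetric_iff_inner_map_self_real]
      intro ξ
      have h3 := Complex.conj_eq_iff_im.2 (h ξ).2.1
      rw [inner_conj_symm] at h3 ⊢
      exact h3.symm
    refine ⟨?_, ContinuousLinearMap.isSelfAdjoint_iff_isSymmetric.2 hsym, ?_⟩
    · rintro z ⟨ξ, hξ, rfl⟩
      refine mem_convRoots_three.2 fun c hc => ?_
      simpa [hξ] using (h ξ).1 c hc
    · rw [ContinuousLinearMap.norm_eq_iSup_rayleighQuotient _ hsym]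
      refine ciSup_le fun ξ => ?_
      rw [ContinuousLinearMap.rayleighQuotient, abs_div, abs_of_nonneg (sq_nonneg ‖ξ‖)]
      refine div_le_one_of_le₀ ?_ (sq_nonneg _)
      have := (h ξ).2.2
      rw [ContinuousLinearMap.reApplyInnerSelf_apply, inner_re_symm]
      exact this
  · rintro ⟨hx, hy, hn⟩
    refine isPrismPair_of_unit fun ξ hξ => ⟨hx ⟨ξ, hξ, rfl⟩, mem_convRoots_two.2 ⟨?_, ?_⟩⟩
    · have := (ContinuousLinearMap.isSelfAdjoint_iff_isSymmetric.1 hy) ξ ξ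
      rw [← Complex.conj_eq_iff_im, inner_conj_symm]
      exact this
    · refine (Complex.abs_re_le_norm _).trans ((norm_inner_le_norm _ _).trans ?_)
      calc ‖ξ‖ * ‖y ξ‖ ≤ ‖ξ‖ * (1 * ‖ξ‖) := by gcongr; exact y.le_of_opNorm_le hn ξ
        _ = 1 := by rw [hξ]; norm_num

/-- The operator `1 + c x + c̄ x*`, whose positivity for `c ^ 3 = 1` expresses one of the three
linear inequalities that define the triangle. -/
def slack [CompleteSpace H] (c : ℂ) (x : H →L[ℂ] H) : H →L[ℂ] H :=
  1 + c • x + star c • ContinuousLinearMap.adjoint x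

theorem inner_slack [CompleteSpace H] (c : ℂ) (ξ : H) :
    ⟪ξ, slack c x ξ⟫_ℂ = ((‖ξ‖ ^ 2 + 2 * (c * ⟪ξ, x ξ⟫_ℂ).re : ℝ) : ℂ) := by
  have h : ⟪x ξ, ξ⟫_ℂ = star ⟪ξ, x ξ⟫_ℂ := (inner_conj_symm _ _).symm
  have h2 : ⟪ξ, ξ⟫_ℂ = ((‖ξ‖ ^ 2 : ℝ) : ℂ) := by simp [inner_self_eq_norm_sq_to_K]
  simp only [slack, add_apply, smul_apply,
    one_apply_eq_self, inner_add_right, inner_smul_right,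
    ContinuousLinearMap.adjoint_inner_right, h, h2]
  apply Complex.ext
  · simp only [Complex.add_re, Complex.mul_re, Complex.ofReal_re, Complex.star_def,
      Complex.conj_re, Complex.conj_im]
    ring
  · simp only [Complex.add_im, Complex.mul_im, Complex.ofReal_im, Complex.star_def,
      Complex.conj_re, Complex.conj_im]
    ring

theorem IsPrismPair.slack_nonneg [CompleteSpace H] (h : IsPrismPair x y) {c : ℂ}
    (hc : c ^ 3 = 1) : 0 ≤ slack c x := by
  rw [ContinuousLinearMap.nonneg_iff_isPositive, ContinuousLinearMap.isPositive_iff_complex]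
  intro ξ
  have h1 : ⟪slack c x ξ, ξ⟫_ℂ = ((‖ξ‖ ^ 2 + 2 * (c * ⟪ξ, x ξ⟫_ℂ).re : ℝ) : ℂ) := by
    rw [← inner_conj_symm, inner_slack, Complex.conj_ofReal]
  rw [h1]
  exact ⟨by simp only [RCLike.re_to_complex, Complex.ofReal_re], (h ξ).1 c hc⟩

theorem IsPrismPair.one_add_smul_nonneg [CompleteSpace H] (h : IsPrismPair x y) {e : ℝ}
    (he : |e| ≤ 1) : 0 ≤ 1 + (e : ℂ) • y := by
  rw [ContinuousLinearMap.nonneg_iff_isPositive, ContinuousLinearMap.isPositive_iff_complex]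
  intro ξ
  have h2 : ⟪ξ, ξ⟫_ℂ = ((‖ξ‖ ^ 2 : ℝ) : ℂ) := by simp [inner_self_eq_norm_sq_to_K]
  have h3 : ⟪y ξ, ξ⟫_ℂ = (((⟪ξ, y ξ⟫_ℂ).re : ℝ) : ℂ) := by
    rw [← inner_conj_symm]
    apply Complex.ext
    · rw [Complex.conj_re, Complex.ofReal_re]
    · rw [Complex.conj_im, (h ξ).2.1, Complex.ofReal_im, neg_zero]
  have h1 : ⟪(1 + (e : ℂ) • y) ξ, ξ⟫_ℂ = ((‖ξ‖ ^ 2 + e * (⟪ξ, y ξ⟫_ℂ).re : ℝ) : ℂ) := by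
    simp only [add_apply, smul_apply,
      one_apply_eq_self, inner_add_left, inner_smul_left, h2, h3]
    simp
  rw [h1]
  refine ⟨by simp only [RCLike.re_to_complex, Complex.ofReal_re], ?_⟩
  have h4 : |e * (⟪ξ, y ξ⟫_ℂ).re| ≤ ‖ξ‖ ^ 2 := by
    rw [abs_mul]
    calc _ ≤ 1 * ‖ξ‖ ^ 2 := by gcongr; exact (h ξ).2.2
      _ = _ := one_mul _
  have := (abs_le.1 h4).1
  simp only [RCLike.re_to_complex, Complex.ofReal_re]
  linarith

end PrismPair

section OfUCP

variable {A : Type u} [CStarAlgebra A] {H : Type v} [NormedAddCommGroup H] [InnerProductSpace ℂ H]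

theorem nonneg_of_ofReal_mul_nonneg {r : ℝ} (hr : 0 < r) {z : ℂ} (h : 0 ≤ (r : ℂ) * z) :
    0 ≤ z := by
  rw [Complex.nonneg_iff, Complex.re_ofReal_mul, Complex.im_ofReal_mul] at h
  refine Complex.nonneg_iff.2 ⟨nonneg_of_mul_nonneg_right h.1 hr, ?_⟩
  exact ((mul_eq_zero.1 h.2.symm).resolve_left hr.ne').symm

/-- A ucp map sends a pair of unitaries of orders three and two to a prism pair: the elements
`(1 + c w + c̄ w*) / 3` and `(1 ± v) / 2` are projections, so that their images are positive. -/
theorem IsUCP.isPrismPair {S : OperatorSystem A} {φ : S.toSubmodule →ₗ[ℂ] (H →L[ℂ] H)}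
    (hφ : IsUCP S φ) {w v : A} (hw : w ∈ S.toSubmodule) (hw' : w ^ 2 ∈ S.toSubmodule)
    (hv : v ∈ S.toSubmodule) (hww : star w = w ^ 2) (hw3 : w ^ 3 = 1) (hvv : star v = v)
    (hv2 : v ^ 2 = 1) :
    IsPrismPair (φ ⟨w, hw⟩) (φ ⟨v, hv⟩) ∧
      ∀ ξ, ⟪ξ, φ ⟨w ^ 2, hw'⟩ ξ⟫_ℂ = star ⟪ξ, φ ⟨w, hw⟩ ξ⟫_ℂ := by
  have hone : ∀ ξ, ⟪ξ, φ S.unit ξ⟫_ℂ = ((‖ξ‖ ^ 2 : ℝ) : ℂ) := fun ξ => by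
    rw [hφ.map_unit]; simp [inner_self_eq_norm_sq_to_K]
  have hc3 : ∀ ξ, ∀ c : ℂ, c ^ 3 = 1 → 0 ≤ ((‖ξ‖ ^ 2 : ℝ) : ℂ) + c * ⟪ξ, φ ⟨w, hw⟩ ξ⟫_ℂ +
      star c * ⟪ξ, φ ⟨w ^ 2, hw'⟩ ξ⟫_ℂ := by
    intro ξ c hc
    have hc2 : star c = c ^ 2 := by
      rcases pow_three_eq_one_iff.1 hc with rfl | rfl | rfl
      · simp
      · rw [pow_two, omega_mul_self]
      · rw [← star_pow, pow_two, omega_mul_self]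
    set b : A := 1 + c • w + c ^ 2 • w ^ 2 with hb
    have hs : ((((3 : ℝ) : ℂ) • (S.unit + c • ⟨w, hw⟩ + c ^ 2 • ⟨w ^ 2, hw'⟩) :
        S.toSubmodule) : A) = star b * b := by
      have hsb : star b = b := by
        rw [hb, star_add, star_add, star_smul, star_smul, star_one, star_pow, star_pow, hww, hc2,
          ← pow_mul, ← pow_mul]
        have h1 : w ^ (2 * 2) = w := by rw [show 2 * 2 = 3 + 1 by rfl, pow_succ, hw3, one_mul]
        have h2 : c ^ (2 * 2) = c := by rw [show 2 * 2 = 3 + 1 by rfl, pow_succ, hc, one_mul]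
        rw [h1, h2]; abel
      have e1 : (c • w) * (c • w) = c ^ 2 • w ^ 2 := by rw [smul_mul_smul_comm, ← pow_two, ← pow_two]
      have e2 : (c • w) * (c ^ 2 • w ^ 2) = 1 := by
        rw [smul_mul_smul_comm, ← pow_succ', ← pow_succ', hc, hw3, one_smul]
      have e3 : (c ^ 2 • w ^ 2) * (c • w) = 1 := by
        rw [smul_mul_smul_comm, ← pow_succ, ← pow_succ, hc, hw3, one_smul]
      have e4 : (c ^ 2 • w ^ 2) * (c ^ 2 • w ^ 2) = c • w := by
        rw [← e1, mul_assoc, e1, e2, mul_one]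
      rw [hsb, hb]
      simp only [mul_add, add_mul, one_mul, mul_one, e1, e2, e3, e4]
      change ((3 : ℝ) : ℂ) • ((1 : A) + c • w + c ^ 2 • w ^ 2) = _
      push_cast
      rw [show (3 : ℂ) = 1 + 1 + 1 by norm_num, add_smul, add_smul, one_smul]
      abel
    have := hφ.inner_nonneg hs ξ
    rw [map_smul, map_add, map_add, map_smul, map_smul, smul_apply,
      inner_smul_right, add_apply, add_apply,
      inner_add_right, inner_add_right, smul_apply,
      smul_apply, inner_smul_right, inner_smul_right, hone] at this
    rw [hc2]
    exact nonneg_of_ofReal_mul_nonneg (by norm_num) this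
  have hpm : ∀ ξ, ∀ e : ℝ, e ^ 2 = 1 → 0 ≤ ((‖ξ‖ ^ 2 : ℝ) : ℂ) + e * ⟪ξ, φ ⟨v, hv⟩ ξ⟫_ℂ := by
    intro ξ e he
    set b : A := 1 + (e : ℂ) • v with hb
    have hs : ((((2 : ℝ) : ℂ) • (S.unit + (e : ℂ) • ⟨v, hv⟩) : S.toSubmodule) : A) =
        star b * b := by
      have hsb : star b = b := by
        rw [hb, star_add, star_smul, star_one, hvv]; simp
      have e1 : ((e : ℂ) • v) * ((e : ℂ) • v) = 1 := by
        rw [smul_mul_smul_comm, ← pow_two, ← pow_two, hv2, ← Complex.ofReal_pow, he]; simp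
      rw [hsb, hb]
      simp only [mul_add, add_mul, one_mul, mul_one, e1]
      change ((2 : ℝ) : ℂ) • ((1 : A) + (e : ℂ) • v) = _
      push_cast
      rw [two_smul]
      abel
    have := hφ.inner_nonneg hs ξ
    rw [map_smul, map_add, map_smul, smul_apply, inner_smul_right,
      add_apply, inner_add_right, smul_apply,
      inner_smul_right, hone] at this
    exact nonneg_of_ofReal_mul_nonneg (by norm_num) this
  refine ⟨fun ξ => ⟨(eq_star_of_nonneg (hc3 ξ)).2, ?_⟩, fun ξ => (eq_star_of_nonneg (hc3 ξ)).1⟩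
  have h1 := Complex.nonneg_iff.1 (hpm ξ 1 (by norm_num))
  have h2 := Complex.nonneg_iff.1 (hpm ξ (-1) (by norm_num))
  rw [Complex.add_re, Complex.add_im, Complex.re_ofReal_mul, Complex.im_ofReal_mul,
    Complex.ofReal_re, Complex.ofReal_im] at h1 h2
  exact ⟨by linarith [h1.2], abs_le.2 ⟨by linarith [h1.1], by linarith [h2.1]⟩⟩

end OfUCP

theorem canonicalUnitary_one {G : Type u} [Group G] : canonicalUnitary (1 : G) = 1 := by
  apply Subtype.ext
  apply Subtype.ext
  funext π
  change ((π.hom 1 : unitary _) : π.space →L[ℂ] π.space) = 1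
  rw [map_one]; rfl

theorem canonW_pow_three : canonW ^ 3 = 1 := by
  have h : gen3 * gen3 * gen3 = 1 := by
    unfold gen3
    rw [← map_mul, ← map_mul, ← map_one Monoid.Coprod.inl]; rfl
  rw [canonW, pow_succ, pow_two, ← canonicalUnitary_mul, ← canonicalUnitary_mul, h,
    canonicalUnitary_one]

theorem canonV_pow_two : canonV ^ 2 = 1 := by
  have h : gen2 * gen2 = 1 := by
    unfold gen2
    rw [← map_mul, ← map_one Monoid.Coprod.inr]; rfl
  rw [canonV, pow_two, ← canonicalUnitary_mul, h, canonicalUnitary_one]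

/-! ### The universal property of the full group C*-algebra -/

/-- A closed subspace spanned by a sequence is the range of an isometry defined on some `ℓ²(I)`,
where the index set `I` (hence the space `ℓ²(I)`) lives in the lowest universe. -/
theorem exists_linearIsometry_range_eq {K : Type v} [NormedAddCommGroup K]
    [InnerProductSpace ℂ K] [CompleteSpace K] (f : ℕ → K) :
    ∃ (I : Type) (U : lp (fun _ : I => ℂ) 2 →ₗᵢ[ℂ] K),
      LinearMap.range U.toLinearMap = (Submodule.span ℂ (Set.range f)).topologicalClosure := by
  have hv := InnerProductSpace.gramSchmidtNormed_orthonormal' (𝕜 := ℂ) f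
  refine ⟨_, hv.orthogonalFamily.linearIsometry, ?_⟩
  rw [OrthogonalFamily.range_linearIsometry]
  congr 1
  rw [← InnerProductSpace.span_gramSchmidt ℂ f,
    ← InnerProductSpace.span_gramSchmidtNormed_range]
  apply le_antisymm
  · refine iSup_le fun i => ?_
    rintro _ ⟨c, rfl⟩
    exact Submodule.smul_mem _ _ (Submodule.subset_span ⟨i, rfl⟩)
  · rw [Submodule.span_le]
    rintro _ ⟨i, rfl⟩
    by_cases hi : InnerProductSpace.gramSchmidtNormed ℂ f i = 0
    · rw [hi]; exact Submodule.zero_mem _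
    · exact Submodule.mem_iSup_of_mem ⟨i, hi⟩ ⟨1, one_smul _ _⟩

section Extension

variable {G : Type} [Group G] {K : Type v} [NormedAddCommGroup K] [InnerProductSpace ℂ K]
  [CompleteSpace K] (π : G →* unitary (K →L[ℂ] K))

theorem adjoint_toContinuousLinearMap_apply {E F : Type*} [NormedAddCommGroup E]
    [InnerProductSpace ℂ E] [CompleteSpace E] [NormedAddCommGroup F] [InnerProductSpace ℂ F]
    [CompleteSpace F] (U : E →ₗᵢ[ℂ] F) (x : E) :
    ContinuousLinearMap.adjoint U.toContinuousLinearMap (U x) = x := by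
  refine ext_inner_left ℂ fun z => ?_
  rw [ContinuousLinearMap.adjoint_inner_right]
  exact U.inner_map_map z x

theorem adjoint_hom (g : G) :
    ContinuousLinearMap.adjoint (π g : K →L[ℂ] K) = (π g⁻¹ : unitary (K →L[ℂ] K)) := by
  rw [map_inv]; rfl

/-- The restriction of a unitary representation to an invariant subspace, given as the range of an
isometry. -/
def compressRep {L : Type} [NormedAddCommGroup L] [InnerProductSpace ℂ L] [CompleteSpace L]
    [Nontrivial L] (U : L →ₗᵢ[ℂ] K)
    (hU : ∀ g η, ∃ ζ, (π g : K →L[ℂ] K) (U η) = U ζ) : UnitaryRep G :=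
  let σ : G → L →L[ℂ] L := fun g => ContinuousLinearMap.adjoint U.toContinuousLinearMap ∘L
    (π g : K →L[ℂ] K) ∘L U.toContinuousLinearMap
  have hσ : ∀ g η, U (σ g η) = (π g : K →L[ℂ] K) (U η) := fun g η => by
    obtain ⟨ζ, hζ⟩ := hU g η
    change U (ContinuousLinearMap.adjoint U.toContinuousLinearMap ((π g : K →L[ℂ] K) (U η))) = _
    rw [hζ, adjoint_toContinuousLinearMap_apply]
  have hone : σ 1 = 1 := by
    ext1 η
    apply U.injective
    rw [hσ, map_one]; rfl
  have hmul : ∀ g h, σ (g * h) = σ g * σ h := fun g h => by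
    ext1 η
    apply U.injective
    change _ = U (σ g (σ h η))
    rw [hσ, hσ, hσ, map_mul]; rfl
  have hstar : ∀ g, star (σ g) = σ g⁻¹ := fun g => by
    change ContinuousLinearMap.adjoint (σ g) = _
    simp only [σ, ContinuousLinearMap.adjoint_comp, ContinuousLinearMap.adjoint_adjoint,
      adjoint_hom]
    rfl
  { space := L
    hom :=
      { toFun := fun g => ⟨σ g, by
          rw [Unitary.mem_iff, hstar, ← hmul, ← hmul, inv_mul_cancel, mul_inv_cancel, hone]
          exact ⟨rfl, rfl⟩⟩
        map_one' := Subtype.ext hone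
        map_mul' := fun g h => Subtype.ext (hmul g h) } }

/-- For a countable group, each vector of a representation in an arbitrary universe lies in (the
isometric image of) a representation in the lowest universe, because the invariant subspace that
the vector generates is separable. -/
theorem exists_unitaryRep_intertwining [Countable G] {ξ : K} (hξ : ξ ≠ 0) :
    ∃ (τ : UnitaryRep G) (U : τ.space →ₗᵢ[ℂ] K),
      (∀ g ζ, U (((τ.hom g : unitary _) : τ.space →L[ℂ] τ.space) ζ) =
        (π g : K →L[ℂ] K) (U ζ)) ∧ ∃ η, U η = ξ := by
  obtain ⟨e, he⟩ := exists_surjective_nat G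
  obtain ⟨I, U, hU⟩ := exists_linearIsometry_range_eq (fun n => (π (e n) : K →L[ℂ] K) ξ)
  have hmem : ∀ g, ∃ ζ, (π g : K →L[ℂ] K) ξ = U ζ := fun g => by
    have : (π g : K →L[ℂ] K) ξ ∈ LinearMap.range U.toLinearMap := by
      rw [hU]
      obtain ⟨n, rfl⟩ := he g
      exact Submodule.le_topologicalClosure _ (Submodule.subset_span ⟨n, rfl⟩)
    obtain ⟨ζ, hζ⟩ := this
    exact ⟨ζ, hζ.symm⟩
  obtain ⟨η, hη⟩ := hmem 1
  have hη' : ξ = U η := by rw [← hη, map_one]; rfl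
  have hinv : ∀ g ζ, ∃ ζ', (π g : K →L[ℂ] K) (U ζ) = U ζ' := by
    intro g ζ
    have hle : (Submodule.span ℂ (Set.range fun n => (π (e n) : K →L[ℂ] K) ξ)).topologicalClosure ≤
        (LinearMap.range U.toLinearMap).comap (π g : K →L[ℂ] K).toLinearMap := by
      apply Submodule.topologicalClosure_minimal
      · rw [Submodule.span_le]
        rintro _ ⟨n, rfl⟩
        obtain ⟨ζ, hζ⟩ := hmem (g * e n)
        refine ⟨ζ, hζ.symm.trans ?_⟩
        rw [map_mul]; rfl
      · rw [hU]
        exact (Submodule.isClosed_topologicalClosure _).preimage (π g : K →L[ℂ] K).continuous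
    rw [← hU] at hle
    obtain ⟨ζ', hζ'⟩ := hle ⟨ζ, rfl⟩
    exact ⟨ζ', hζ'.symm⟩
  have : Nontrivial (lp (fun _ : I => ℂ) 2) := ⟨η, 0, by
    rintro rfl
    exact hξ (by rw [hη', map_zero])⟩
  refine ⟨compressRep π U hinv, U, fun g ζ => ?_, η, hη'.symm⟩
  obtain ⟨ζ', hζ'⟩ := hinv g ζ
  change U (ContinuousLinearMap.adjoint U.toContinuousLinearMap ((π g : K →L[ℂ] K) (U ζ))) = _
  rw [hζ', adjoint_toContinuousLinearMap_apply]
  exact hζ'.symm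

/-- The norm of `C*(G)`, defined through representations in the lowest universe, dominates the
norm of every representation of a countable group. -/
theorem norm_linearCombination_le [Countable G] (f : G →₀ ℂ) :
    ‖Finsupp.linearCombination ℂ (fun g => (π g : K →L[ℂ] K)) f‖ ≤
      1 * ‖Finsupp.linearCombination ℂ (canonicalUnitary : G → GroupCStar G) f‖ := by
  rw [one_mul]
  refine ContinuousLinearMap.opNorm_le_bound _ (norm_nonneg _) fun ξ => ?_
  rcases eq_or_ne ξ 0 with rfl | hξ
  · simp
  obtain ⟨τ, U, hval, η, rfl⟩ := exists_unitaryRep_intertwining π hξ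
  -- The coordinate projection of `C*(G)` at the representation `τ` is a contraction.
  have hcoord : ‖Finsupp.linearCombination ℂ
      (fun g => ((τ.hom g : unitary _) : τ.space →L[ℂ] τ.space)) f‖ ≤
      ‖Finsupp.linearCombination ℂ (canonicalUnitary : G → GroupCStar G) f‖ := by
    let ev : GroupCStar G →ₗ[ℂ] (τ.space →L[ℂ] τ.space) :=
      { toFun := fun a => a.1 τ
        map_add' := fun _ _ => rfl
        map_smul' := fun _ _ => rfl }
    have h2 : ev (Finsupp.linearCombination ℂ (canonicalUnitary : G → GroupCStar G) f) =
        Finsupp.linearCombination ℂ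
          (fun g => ((τ.hom g : unitary _) : τ.space →L[ℂ] τ.space)) f := by
      rw [Finsupp.apply_linearCombination]; rfl
    rw [← h2]
    exact lp.norm_apply_le_norm (by simp) (Subtype.val _) τ
  have hlin : Finsupp.linearCombination ℂ (fun g => (π g : K →L[ℂ] K)) f (U η) =
      U ((Finsupp.linearCombination ℂ
        (fun g => ((τ.hom g : unitary _) : τ.space →L[ℂ] τ.space)) f) η) := by
    simp only [Finsupp.linearCombination_apply, Finsupp.sum, sum_apply, map_sum, smul_apply,
      map_smul, hval]
  rw [hlin, U.norm_map, U.norm_map]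
  exact (ContinuousLinearMap.le_opNorm _ η).trans (by gcongr)

theorem mem_span_canonicalUnitary {a : RepProduct G}
    (ha : a ∈ StarAlgebra.adjoin ℂ (Set.range (universalRep : G → RepProduct G))) :
    ∃ b ∈ Submodule.span ℂ (Set.range (canonicalUnitary : G → GroupCStar G)), b.1 = a := by
  induction ha using StarAlgebra.adjoin_induction with
  | mem x hx =>
    obtain ⟨g, rfl⟩ := hx
    exact ⟨canonicalUnitary g, Submodule.subset_span ⟨g, rfl⟩, rfl⟩
  | algebraMap r =>
    refine ⟨r • canonicalUnitary 1, Submodule.smul_mem _ _ (Submodule.subset_span ⟨1, rfl⟩), ?_⟩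
    rw [canonicalUnitary_one, Algebra.algebraMap_eq_smul_one]; rfl
  | add x y _ _ hx hy =>
    obtain ⟨b, hb, rfl⟩ := hx
    obtain ⟨c, hc, rfl⟩ := hy
    exact ⟨b + c, Submodule.add_mem _ hb hc, rfl⟩
  | mul x y _ _ hx hy =>
    obtain ⟨b, hb, rfl⟩ := hx
    obtain ⟨c, hc, rfl⟩ := hy
    refine ⟨b * c, ?_, rfl⟩
    have := Submodule.mul_mem_mul hb hc
    rw [Submodule.span_mul_span] at this
    refine Submodule.span_mono ?_ this
    rintro _ ⟨_, ⟨g, rfl⟩, _, ⟨h, rfl⟩, rfl⟩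
    exact ⟨g * h, canonicalUnitary_mul g h⟩
  | star x _ hx =>
    obtain ⟨b, hb, rfl⟩ := hx
    refine ⟨star b, ?_, rfl⟩
    -- The induction below is on the membership of `b` alone.
    clear * - hb
    induction hb using Submodule.span_induction with
    | mem y hy =>
      obtain ⟨g, rfl⟩ := hy
      exact Submodule.subset_span ⟨g⁻¹, (canonicalUnitary_star g).symm⟩
    | zero => rw [star_zero]; exact Submodule.zero_mem _
    | add y z _ _ hy hz => rw [star_add]; exact Submodule.add_mem _ hy hz
    | smul c y _ hy => rw [star_smul]; exact Submodule.smul_mem _ _ hy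

theorem dense_span_canonicalUnitary :
    Dense (Submodule.span ℂ (Set.range (canonicalUnitary : G → GroupCStar G)) :
      Set (GroupCStar G)) := by
  intro a
  have hemb : Topology.IsInducing (fun b : GroupCStar G => (b.1 : RepProduct G)) := ⟨rfl⟩
  rw [hemb.closure_eq_preimage_closure_image]
  have h : (a.1 : RepProduct G) ∈
      closure (StarAlgebra.adjoin ℂ (Set.range (universalRep : G → RepProduct G)) :
        Set (RepProduct G)) := a.2
  refine closure_mono ?_ h
  intro x hx
  obtain ⟨b, hb, rfl⟩ := mem_span_canonicalUnitary hx
  exact ⟨b, hb, rfl⟩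

/-- Every unitary representation of a countable group on a Hilbert space (in any universe)
extends to a `*`-representation of the full group C*-algebra. -/
theorem exists_extension [Countable G] : ∃ ρ : GroupCStar G →ₗ[ℂ] (K →L[ℂ] K),
    (∀ g, ρ (canonicalUnitary g) = (π g : K →L[ℂ] K)) ∧
    ∀ a b, ρ (star a * b) = ContinuousLinearMap.adjoint (ρ a) ∘L ρ b := by
  have hdense : DenseRange
      (Finsupp.linearCombination ℂ (canonicalUnitary : G → GroupCStar G)) := by
    have := dense_span_canonicalUnitary (G := G)
    rwa [← Finsupp.range_linearCombination] at this
  set ρ := (Finsupp.linearCombination ℂ (fun g => (π g : K →L[ℂ] K))).extendOfNorm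
    (Finsupp.linearCombination ℂ (canonicalUnitary : G → GroupCStar G)) with hρ
  have hval : ∀ g, ρ (canonicalUnitary g) = (π g : K →L[ℂ] K) := fun g => by
    have h1 : Finsupp.linearCombination ℂ (canonicalUnitary : G → GroupCStar G)
        (Finsupp.single g 1) = canonicalUnitary g := by
      rw [Finsupp.linearCombination_single, one_smul]
    rw [← h1]
    refine (LinearMap.extendOfNorm_eq hdense ⟨1, norm_linearCombination_le π⟩
      (Finsupp.single g 1)).trans ?_
    rw [Finsupp.linearCombination_single, one_smul]
  refine ⟨ρ.toLinearMap, hval, ?_⟩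
  have hb : ∀ g b, ρ (star (canonicalUnitary g) * b) =
      ContinuousLinearMap.adjoint (ρ (canonicalUnitary g)) * ρ b := by
    intro g b
    refine dense_span_canonicalUnitary.induction
      (P := fun b => ρ (star (canonicalUnitary g) * b) =
        ContinuousLinearMap.adjoint (ρ (canonicalUnitary g)) * ρ b) ?_ ?_ b
    · intro b hb
      induction hb using Submodule.span_induction with
      | mem y hy =>
        obtain ⟨h, rfl⟩ := hy
        rw [canonicalUnitary_star, ← canonicalUnitary_mul, hval, hval, hval, adjoint_hom,
          map_mul]
        rfl
      | zero => rw [mul_zero, ρ.map_zero, mul_zero]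
      | add y z _ _ hy hz => rw [mul_add, map_add, map_add, mul_add, hy, hz]
      | smul c y _ hy => rw [mul_smul_comm, map_smul, map_smul, mul_smul_comm, hy]
    · exact isClosed_eq (by fun_prop) (by fun_prop)
  intro a b
  change ρ (star a * b) = ContinuousLinearMap.adjoint (ρ a) * ρ b
  refine dense_span_canonicalUnitary.induction
    (P := fun a => ρ (star a * b) = ContinuousLinearMap.adjoint (ρ a) * ρ b) ?_ ?_ a
  · intro a ha
    induction ha using Submodule.span_induction with
    | mem y hy =>
      obtain ⟨g, rfl⟩ := hy
      exact hb g b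
    | zero => rw [star_zero, zero_mul, ρ.map_zero, map_zero, zero_mul]
    | add y z _ _ hy hz => rw [star_add, add_mul, map_add, map_add, map_add, add_mul, hy, hz]
    | smul c y _ hy =>
      rw [star_smul, smul_mul_assoc, map_smul, map_smul, hy, map_smulₛₗ, smul_mul_assoc]; rfl
  · exact isClosed_eq (by fun_prop) (by fun_prop)

end Extension

instance : Countable FreeProd32 := Monoid.Coprod.mk_surjective.countable

/-! ### Dilation of three positive operators with sum one -/

section Dilation

variable {H : Type v} [NormedAddCommGroup H] [InnerProductSpace ℂ H] [CompleteSpace H]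

/-- The direct sum of four copies of `H`, the space of the dilation. The summand `none` carries
the operators to be dilated, the other three carry the dilation of a positive operator valued
measure on three points. -/
abbrev DilationSpace (H : Type v) [NormedAddCommGroup H] : Type v :=
  PiLp 2 (fun _ : Option (Fin 3) => H)

/-- The inclusion of `H` into `DilationSpace H` as the summand `k`. -/
def incl (k : Option (Fin 3)) : H →L[ℂ] DilationSpace H :=
  ContinuousLinearMap.adjoint (PiLp.proj 2 (fun _ : Option (Fin 3) => H) k)

theorem adjoint_incl_apply (k : Option (Fin 3)) (f : DilationSpace H) :
    ContinuousLinearMap.adjoint (incl k) f = f k := by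
  rw [incl, ContinuousLinearMap.adjoint_adjoint]; rfl

theorem incl_apply (k j : Option (Fin 3)) (ξ : H) :
    (incl k ξ : DilationSpace H) j = if j = k then ξ else 0 := by
  have : (incl k ξ : DilationSpace H) = PiLp.single 2 k ξ := by
    refine ext_inner_left ℂ fun f => ?_
    rw [incl, ContinuousLinearMap.adjoint_inner_right, PiLp.inner_apply, Finset.sum_eq_single k]
    · simp
    · intro j _ hj
      simp [hj]
    · simp
  rw [this]
  rcases eq_or_ne j k with rfl | h <;> simp [*]

/-- The diagonal operator with entries `1` on the summand `none` and `d k` on the summand `k`. -/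
def diagOp (d : Fin 3 → ℂ) : DilationSpace H →L[ℂ] DilationSpace H :=
  ∑ k, Option.elim k 1 d • (incl k ∘L ContinuousLinearMap.adjoint (incl k))

theorem diagOp_apply (d : Fin 3 → ℂ) (f : DilationSpace H) (j : Option (Fin 3)) :
    diagOp d f j = Option.elim j 1 d • f j := by
  cases j <;> simp [diagOp, adjoint_incl_apply, incl_apply]

/-- `diagOp`, as a multiplicative function of the diagonal. -/
def diagHom : (Fin 3 → ℂ) →* (DilationSpace H →L[ℂ] DilationSpace H) where
  toFun := diagOp
  map_one' := by
    ext f j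
    rw [diagOp_apply]
    cases j <;> simp
  map_mul' d e := by
    ext f j
    rw [diagOp_apply]
    change _ = diagOp d (diagOp e f) j
    rw [diagOp_apply, diagOp_apply]
    cases j <;> simp [mul_smul]

theorem diagHom_apply (d : Fin 3 → ℂ) (f : DilationSpace H) (j : Option (Fin 3)) :
    diagHom d f j = Option.elim j 1 d • f j :=
  diagOp_apply d f j

theorem adjoint_diagHom (d : Fin 3 → ℂ) :
    ContinuousLinearMap.adjoint (diagHom d : DilationSpace H →L[ℂ] DilationSpace H) =
      diagHom (star d) := by
  symm
  rw [ContinuousLinearMap.eq_adjoint_iff]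
  intro f g
  simp only [PiLp.inner_apply, diagHom_apply, inner_smul_left, inner_smul_right]
  refine Finset.sum_congr rfl fun k _ => ?_
  cases k <;> simp

/-- For orthogonal isometries `V` and `J`, the selfadjoint unitary that interchanges their
ranges (through `J ξ ↔ V ξ`) and fixes the orthogonal complement. -/
def swap {K : Type w} [NormedAddCommGroup K] [InnerProductSpace ℂ K] [CompleteSpace K]
    (V J : H →L[ℂ] K) : K →L[ℂ] K :=
  1 - V ∘L ContinuousLinearMap.adjoint V - J ∘L ContinuousLinearMap.adjoint J +
    V ∘L ContinuousLinearMap.adjoint J + J ∘L ContinuousLinearMap.adjoint V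

section Swap

variable {K : Type w} [NormedAddCommGroup K] [InnerProductSpace ℂ K] [CompleteSpace K]
  {V J : H →L[ℂ] K}

theorem adjoint_swap : ContinuousLinearMap.adjoint (swap V J) = swap V J := by
  have : ContinuousLinearMap.adjoint (1 : K →L[ℂ] K) = 1 := star_one (K →L[ℂ] K)
  simp only [swap, map_add, map_sub, ContinuousLinearMap.adjoint_comp,
    ContinuousLinearMap.adjoint_adjoint, this]
  abel

theorem swap_apply (f : K) : swap V J f = f - V (ContinuousLinearMap.adjoint V f) -
    J (ContinuousLinearMap.adjoint J f) + V (ContinuousLinearMap.adjoint J f) +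
    J (ContinuousLinearMap.adjoint V f) := rfl

theorem swap_mul_swap (hV : ∀ ξ, ContinuousLinearMap.adjoint V (V ξ) = ξ) (hJ : ∀ ξ, ContinuousLinearMap.adjoint J (J ξ) = ξ)
    (hVJ : ∀ ξ, ContinuousLinearMap.adjoint V (J ξ) = 0) (hJV : ∀ ξ, ContinuousLinearMap.adjoint J (V ξ) = 0) :
    swap V J * swap V J = 1 := by
  ext1 f
  change swap V J (swap V J f) = f
  rw [swap_apply (swap V J f)]
  have h1 : ContinuousLinearMap.adjoint V (swap V J f) = ContinuousLinearMap.adjoint J f := by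
    simp [swap_apply, hV, hVJ]
  have h2 : ContinuousLinearMap.adjoint J (swap V J f) = ContinuousLinearMap.adjoint V f := by
    simp [swap_apply, hJ, hJV]
  rw [h1, h2, swap_apply]
  abel

theorem swap_apply_right (hJ : ∀ ξ, ContinuousLinearMap.adjoint J (J ξ) = ξ) (hVJ : ∀ ξ, ContinuousLinearMap.adjoint V (J ξ) = 0) (ξ : H) :
    swap V J (J ξ) = V ξ := by
  simp [swap_apply, hJ, hVJ]

end Swap

/-- A form of Naimark's dilation theorem for three positive operators `P k` with sum one: there is
a commuting family of normal operators `W d`, multiplicative in `d : Fin 3 → ℂ`, that dilate the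
operators `∑ k, d k • P k`. The space of the dilation and the embedding do not depend on the
`P k`. -/
theorem exists_dilation (P : Fin 3 → H →L[ℂ] H) (hP : ∀ k, 0 ≤ P k) (hsum : ∑ k, P k = 1) :
    ∃ W : (Fin 3 → ℂ) →* (DilationSpace H →L[ℂ] DilationSpace H),
      (∀ d, star (W d) = W (star d)) ∧
      ∀ d, ContinuousLinearMap.adjoint (incl none) ∘L W d ∘L incl none = ∑ k, d k • P k := by
  set S : Fin 3 → H →L[ℂ] H := fun k => CFC.sqrt (P k) with hS
  have hSS : ∀ k ξ, S k (S k ξ) = P k ξ := fun k ξ =>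
    congrArg (fun T : H →L[ℂ] H => T ξ) (CFC.sqrt_mul_sqrt_self (P k) (hP k))
  have hSa : ∀ k, ContinuousLinearMap.adjoint (S k) = S k := fun k =>
    (CFC.sqrt_nonneg (P k)).isSelfAdjoint
  set V : H →L[ℂ] DilationSpace H := ∑ k : Fin 3, incl (some k) ∘L S k with hVdef
  have hVa : ∀ f, ContinuousLinearMap.adjoint V f = ∑ k : Fin 3, S k (f (some k)) := fun f => by
    simp only [hVdef, map_sum, ContinuousLinearMap.adjoint_comp, hSa, sum_apply,
      ContinuousLinearMap.comp_apply, adjoint_incl_apply]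
  have hVs : ∀ ξ k, V ξ (some k) = S k ξ := fun ξ k => by
    simp [hVdef, incl_apply]
  have hVn : ∀ ξ, V ξ none = 0 := fun ξ => by
    simp [hVdef, incl_apply]
  have hV : ∀ ξ, ContinuousLinearMap.adjoint V (V ξ) = ξ := fun ξ => by
    simp only [hVa, hVs, hSS]
    rw [← sum_apply, hsum]; rfl
  have hJ : ∀ ξ : H, ContinuousLinearMap.adjoint (incl none) (incl none ξ) = ξ := fun ξ => by
    simp [adjoint_incl_apply, incl_apply]
  have hVJ : ∀ ξ, ContinuousLinearMap.adjoint V (incl none ξ) = 0 := fun ξ => by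
    simp [hVa, incl_apply]
  have hJV : ∀ ξ, ContinuousLinearMap.adjoint (incl none) (V ξ) = 0 := fun ξ => by
    rw [adjoint_incl_apply, hVn]
  set R := swap V (incl none) with hR
  have hRR : R * R = 1 := swap_mul_swap hV hJ hVJ hJV
  have hRa : star R = R := adjoint_swap
  have h1 : ∀ ξ, R (incl none ξ) = V ξ := swap_apply_right hJ hVJ
  have h2 : ∀ f, ContinuousLinearMap.adjoint (incl none) (R f) =
      ContinuousLinearMap.adjoint V f := fun f => by
    refine ext_inner_left ℂ fun ζ => ?_
    rw [ContinuousLinearMap.adjoint_inner_right, ContinuousLinearMap.adjoint_inner_right,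
      ← ContinuousLinearMap.adjoint_inner_left, hR, adjoint_swap, ← hR, h1]
  clear_value R
  -- Conjugation by the involution `R` is multiplicative.
  have hmul : ∀ a b : DilationSpace H →L[ℂ] DilationSpace H,
      R * (a * b) * R = R * a * R * (R * b * R) := fun a b => by
    calc R * (a * b) * R = R * a * 1 * (b * R) := by simp only [mul_one, mul_assoc]
      _ = R * a * (R * R) * (b * R) := by rw [hRR]
      _ = _ := by simp only [mul_assoc]
  let W : (Fin 3 → ℂ) →* (DilationSpace H →L[ℂ] DilationSpace H) :=
    { toFun := fun d => R * diagHom d * R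
      map_one' := by rw [map_one, mul_one, hRR]
      map_mul' := fun d e => by rw [map_mul, hmul] }
  have hW : ∀ d, W d = R * diagHom d * R := fun d => rfl
  clear_value W
  refine ⟨W, fun d => ?_, fun d => ?_⟩
  · have h2 : star (diagHom d : DilationSpace H →L[ℂ] DilationSpace H) = diagHom (star d) :=
      adjoint_diagHom d
    rw [hW, hW, star_mul, star_mul, hRa, h2, mul_assoc]
  · ext1 ξ
    rw [hW]
    change ContinuousLinearMap.adjoint (incl none) (R (diagHom d (R (incl none ξ)))) = _
    rw [h1, h2, hVa]
    simp only [diagHom_apply, Option.elim_some, hVs, map_smul, hSS, sum_apply, smul_apply]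

end Dilation

/-! ### Ucp maps from prism pairs -/

/-- The homomorphism from `ℤ/n`, written multiplicatively, that sends the generator to an element
`u` with `u ^ n = 1`. -/
def zmodHom {Γ : Type v} [Group Γ] (n : ℕ) (u : Γ) (hu : u ^ n = 1) :
    Multiplicative (ZMod n) →* Γ :=
  AddMonoidHom.toMultiplicativeLeft
    (ZMod.lift n ⟨zmultiplesHom (Additive Γ) (Additive.ofMul u), by
      rw [zmultiplesHom_apply, natCast_zsmul, ← ofMul_pow, hu, ofMul_one]⟩)

theorem zmodHom_ofAdd_one {Γ : Type v} [Group Γ] (n : ℕ) (u : Γ) (hu : u ^ n = 1) :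
    zmodHom n u hu (Multiplicative.ofAdd 1) = u := by
  have : (1 : ZMod n) = ((1 : ℤ) : ZMod n) := by simp
  change Additive.toMul (ZMod.lift n _ 1) = u
  rw [this, ZMod.lift_coe]
  simp

section

variable {H : Type v} [NormedAddCommGroup H] [InnerProductSpace ℂ H] [CompleteSpace H]

/-- Three positive operators `P k` with sum one and roots of unity `d k` of order `n` give rise to
a unitary of order `n` that dilates `∑ k, d k • P k`. -/
theorem exists_unitary_dilation (P : Fin 3 → H →L[ℂ] H) (hP : ∀ k, 0 ≤ P k)
    (hsum : ∑ k, P k = 1) (d : Fin 3 → ℂ) (hd : star d * d = 1) {n : ℕ} (hn : d ^ n = 1) :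
    ∃ u : unitary (DilationSpace H →L[ℂ] DilationSpace H), u ^ n = 1 ∧
      ContinuousLinearMap.adjoint (incl none) ∘L
        (u : DilationSpace H →L[ℂ] DilationSpace H) ∘L incl none = ∑ k, d k • P k := by
  obtain ⟨W, hW, hWd⟩ := exists_dilation P hP hsum
  refine ⟨⟨W d, ?_⟩, ?_, hWd d⟩
  · rw [Unitary.mem_iff, hW, ← map_mul, ← map_mul, mul_comm d, hd, map_one]
    exact ⟨rfl, rfl⟩
  · apply Subtype.ext
    change W d ^ n = 1
    rw [← map_pow, hn, map_one]

/-- A prism pair is the image of the canonical unitaries under a ucp map on `C*(ℤ₃ * ℤ₂)`. The two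
operators have unitary dilations of orders three and two on the same space and with the same
embedding, and no relation between these two unitaries is needed to represent the free product. -/
theorem IsPrismPair.exists_isUCP {x y : H →L[ℂ] H} (h : IsPrismPair x y) :
    ∃ φ : (OperatorSystem.whole (GroupCStar FreeProd32)).toSubmodule →ₗ[ℂ] (H →L[ℂ] H),
      IsUCP (OperatorSystem.whole (GroupCStar FreeProd32)) φ ∧
      φ ⟨canonW, Submodule.mem_top⟩ = x ∧ φ ⟨canonV, Submodule.mem_top⟩ = y := by
  have hsmul : ∀ (r : ℝ) (T : H →L[ℂ] H), 0 ≤ r → 0 ≤ T → 0 ≤ (r : ℂ) • T := fun r T hr hT => by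
    rw [ContinuousLinearMap.nonneg_iff_isPositive] at hT ⊢
    exact hT.smul_of_nonneg (Complex.zero_le_real.2 hr)
  have ha := omega_add_star
  have hm := omega_mul_star
  have hs := omega_mul_self
  have hs' : star omega * star omega = omega := by rw [← star_mul, hs, star_star]
  -- The barycentric coordinates of `x` in the triangle with the vertices `1`, `ω`, `ω̄`.
  obtain ⟨u, hu3, hu⟩ : ∃ u : unitary (DilationSpace H →L[ℂ] DilationSpace H), u ^ 3 = 1 ∧
      ContinuousLinearMap.adjoint (incl none) ∘L
        (u : DilationSpace H →L[ℂ] DilationSpace H) ∘L incl none = x := by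
    have key := exists_unitary_dilation
      ![(((1 / 3 : ℝ)) : ℂ) • slack 1 x, ((1 / 3 : ℝ) : ℂ) • slack (star omega) x,
        ((1 / 3 : ℝ) : ℂ) • slack omega x] ?_ ?_ ![1, omega, star omega] ?_ (n := 3) ?_
    · convert key using 5
      simp only [Fin.sum_univ_three, Matrix.cons_val, slack, smul_add, smul_smul, star_star,
        star_one]
      push_cast
      match_scalars
      · linear_combination -2 * hm / 3
      · linear_combination -ha / 3
      · linear_combination -(hs + hs' + ha) / 3
    · intro k
      fin_cases k
      · exact hsmul _ _ (by norm_num) (h.slack_nonneg (one_pow _))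
      · exact hsmul _ _ (by norm_num) (h.slack_nonneg star_omega_pow_three)
      · exact hsmul _ _ (by norm_num) (h.slack_nonneg omega_pow_three)
    · simp only [Fin.sum_univ_three, Matrix.cons_val, slack, smul_add, smul_smul, star_star,
        star_one]
      push_cast
      match_scalars
      · norm_num
      · linear_combination ha / 3
      · linear_combination ha / 3
    · ext k
      fin_cases k
      · simp
      · change star omega * omega = 1
        rw [mul_comm, omega_mul_star]
      · change star (star omega) * star omega = 1
        rw [star_star, omega_mul_star]
    · ext k
      fin_cases k
      · exact one_pow _
      · exact omega_pow_three
      · exact star_omega_pow_three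
  -- The barycentric coordinates of `y` in the segment; the third operator is zero, so that its
  -- coefficient `1` only serves to keep the dilation unitary.
  obtain ⟨t, ht2, ht⟩ : ∃ u : unitary (DilationSpace H →L[ℂ] DilationSpace H), u ^ 2 = 1 ∧
      ContinuousLinearMap.adjoint (incl none) ∘L
        (u : DilationSpace H →L[ℂ] DilationSpace H) ∘L incl none = y := by
    have key := exists_unitary_dilation
      ![((1 / 2 : ℝ) : ℂ) • (1 + ((1 : ℝ) : ℂ) • y),
        ((1 / 2 : ℝ) : ℂ) • (1 + ((-1 : ℝ) : ℂ) • y), 0] ?_ ?_ ![1, -1, 1] ?_ (n := 2) ?_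
    · convert key using 5
      simp only [Fin.sum_univ_three, Matrix.cons_val, smul_add, smul_smul]
      push_cast
      module
    · intro k
      fin_cases k
      · exact hsmul _ _ (by norm_num) (h.one_add_smul_nonneg (by norm_num))
      · exact hsmul _ _ (by norm_num) (h.one_add_smul_nonneg (by norm_num))
      · exact le_rfl
    · simp only [Fin.sum_univ_three, Matrix.cons_val, smul_add, smul_smul]
      push_cast
      module
    · ext k
      fin_cases k <;> simp
    · ext k
      fin_cases k <;> simp
  obtain ⟨ρ, hρ, hρmul⟩ := exists_extension
    (Monoid.Coprod.lift (zmodHom 3 u hu3) (zmodHom 2 t ht2))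
  have hρw : ρ canonW = u := by
    rw [canonW, hρ, gen3, Monoid.Coprod.lift_apply_inl, zmodHom_ofAdd_one]
  have hρv : ρ canonV = t := by
    rw [canonV, hρ, gen2, Monoid.Coprod.lift_apply_inr, zmodHom_ofAdd_one]
  have hρone : ρ 1 = 1 := by
    rw [← canonicalUnitary_one, hρ, map_one]; rfl
  let cmp : (DilationSpace H →L[ℂ] DilationSpace H) →ₗ[ℂ] (H →L[ℂ] H) :=
    { toFun := fun T => ContinuousLinearMap.adjoint (incl none) ∘L T ∘L incl none
      map_add' := fun S T => by simp
      map_smul' := fun c T => by simp }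
  refine ⟨cmp ∘ₗ ρ ∘ₗ (OperatorSystem.whole (GroupCStar FreeProd32)).toSubmodule.subtype,
    isUCP_compression _ ρ hρone hρmul (incl none) ?_ _ fun s => rfl, ?_, ?_⟩
  · ext1 ξ
    simp [adjoint_incl_apply, incl_apply]
  · change ContinuousLinearMap.adjoint (incl none) ∘L ρ canonW ∘L incl none = x
    rw [hρw, hu]
  · change ContinuousLinearMap.adjoint (incl none) ∘L ρ canonV ∘L incl none = y
    rw [hρv, ht]

end

/-! ### The noncommutative numerical range of the canonical unitaries -/

theorem IsUCP.isPrismPair_canon {S : OperatorSystem (GroupCStar FreeProd32)} {H : Type v}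
    [NormedAddCommGroup H] [InnerProductSpace ℂ H] {φ : S.toSubmodule →ₗ[ℂ] (H →L[ℂ] H)}
    (hφ : IsUCP S φ) (hw : canonW ∈ S.toSubmodule) (hw' : canonW ^ 2 ∈ S.toSubmodule)
    (hv : canonV ∈ S.toSubmodule) :
    IsPrismPair (φ ⟨canonW, hw⟩) (φ ⟨canonV, hv⟩) ∧
      ∀ ξ, ⟪ξ, φ ⟨canonW ^ 2, hw'⟩ ξ⟫_ℂ = star ⟪ξ, φ ⟨canonW, hw⟩ ξ⟫_ℂ :=
  hφ.isPrismPair hw hw' hv star_canonW canonW_pow_three star_canonV canonV_pow_two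

/-- A ucp map is hermitian on the unitary of order three. -/
theorem IsUCP.map_canonW_sq {S : OperatorSystem (GroupCStar FreeProd32)} {H : Type v}
    [NormedAddCommGroup H] [InnerProductSpace ℂ H] [CompleteSpace H]
    {φ : S.toSubmodule →ₗ[ℂ] (H →L[ℂ] H)}
    (hφ : IsUCP S φ) (hw : canonW ∈ S.toSubmodule) (hw' : canonW ^ 2 ∈ S.toSubmodule)
    (hv : canonV ∈ S.toSubmodule) :
    φ ⟨canonW ^ 2, hw'⟩ = ContinuousLinearMap.adjoint (φ ⟨canonW, hw⟩) := by
  have h := (hφ.isPrismPair_canon hw hw' hv).2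
  have : (φ ⟨canonW ^ 2, hw'⟩ : H →ₗ[ℂ] H) = ContinuousLinearMap.adjoint (φ ⟨canonW, hw⟩) := by
    rw [← ext_inner_map]
    intro ξ
    change ⟪φ ⟨canonW ^ 2, hw'⟩ ξ, ξ⟫_ℂ =
      ⟪ContinuousLinearMap.adjoint (φ ⟨canonW, hw⟩) ξ, ξ⟫_ℂ
    rw [ContinuousLinearMap.adjoint_inner_left, ← inner_conj_symm, h ξ]
    exact star_star _
  exact ContinuousLinearMap.coe_injective this

theorem mem_ncRange_iff {n : Level} {a : Fin 2 → Op n} :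
    a ∈ ncRange ![canonW, canonV] n ↔ IsPrismPair (a 0) (a 1) := by
  constructor
  · rintro ⟨φ, hφ, ha⟩
    have hw := mem_opSysOf ![canonW, canonV] 0
    have hv := mem_opSysOf ![canonW, canonV] 1
    have hw' : canonW ^ 2 ∈ (opSysOf ![canonW, canonV]).toSubmodule :=
      star_canonW ▸ (opSysOf ![canonW, canonV]).star_mem' hw
    rw [ha 0, ha 1]
    exact (hφ.isPrismPair_canon hw hw' hv).1
  · intro h
    obtain ⟨φ, hφ, hw, hv⟩ := h.exists_isUCP
    refine ⟨_, hφ.restrict (S := opSysOf ![canonW, canonV]) le_top, fun j => ?_⟩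
    fin_cases j
    · exact hw.symm
    · exact hv.symm

/-- The vector state of a vector `ξ` on operators, with values in the operators on `ℓ²(1)`. -/
theorem exists_vectorState {n : Level} (S : OperatorSystem (Op n)) {ξ : Hilb n} (hξ : ‖ξ‖ = 1) :
    ∃ φ : S.toSubmodule →ₗ[ℂ] Op ⟨1, le_rfl⟩, IsUCP S φ ∧
      ∀ s : S.toSubmodule, φ s = ⟪ξ, (s : Op n) ξ⟫_ℂ • (1 : Op ⟨1, le_rfl⟩) := by
  let φ : S.toSubmodule →ₗ[ℂ] Op ⟨1, le_rfl⟩ :=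
    { toFun := fun s => ⟪ξ, (s : Op n) ξ⟫_ℂ • (1 : Op ⟨1, le_rfl⟩)
      map_add' := fun s t => by
        rw [← add_smul, ← inner_add_right]; rfl
      map_smul' := fun c s => by
        rw [RingHom.id_apply, smul_smul, ← smul_eq_mul, smul_eq_mul, ← inner_smul_right]; rfl }
  have hone : ⟪ξ, ξ⟫_ℂ = 1 := by rw [inner_self_eq_norm_sq_to_K, hξ]; simp
  let i₀ : {k : ℕ // (k : ℕ∞) < (⟨1, le_rfl⟩ : Level).1} := ⟨0, by simp⟩
  have huniq : ∀ i : {k : ℕ // (k : ℕ∞) < (⟨1, le_rfl⟩ : Level).1}, i = i₀ := fun i => by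
    apply Subtype.ext
    have := i.2
    simpa using this
  have hinner : ∀ e f : Hilb ⟨1, le_rfl⟩, ⟪e, f⟫_ℂ = star (e i₀) * f i₀ := fun e f => by
    rw [lp.inner_eq_tsum, tsum_eq_single i₀ (fun i hi => absurd (huniq i) hi)]
    exact mul_comm _ _
  let ev : Hilb ⟨1, le_rfl⟩ →L[ℂ] ℂ := innerSL ℂ (lp.single 2 i₀ (1 : ℂ))
  have hev : ∀ e, ev e = e i₀ := fun e => by
    change ⟪lp.single 2 i₀ (1 : ℂ), e⟫_ℂ = _
    rw [lp.inner_single_left]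
    simp
  let V : Hilb ⟨1, le_rfl⟩ →L[ℂ] Hilb n := (ContinuousLinearMap.toSpanSingleton ℂ ξ) ∘L ev
  have hV : ∀ e, V e = e i₀ • ξ := fun e => by
    change ev e • ξ = _
    rw [hev]
  have hVT : ∀ T : Op n, ContinuousLinearMap.adjoint V ∘L T ∘L V =
      ⟪ξ, T ξ⟫_ℂ • (1 : Op ⟨1, le_rfl⟩) := fun T => by
    ext1 e
    refine ext_inner_left ℂ fun f => ?_
    rw [ContinuousLinearMap.comp_apply, ContinuousLinearMap.adjoint_inner_right]
    change ⟪V f, T (V e)⟫_ℂ = ⟪f, ⟪ξ, T ξ⟫_ℂ • e⟫_ℂ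
    rw [hV, hV, map_smul, inner_smul_left, inner_smul_right, inner_smul_right, hinner]
    simp only [Complex.star_def]
    ring
  refine ⟨φ, isUCP_compression S LinearMap.id rfl (fun a b => rfl) V ?_ φ fun s => ?_, fun s => rfl⟩
  · have := hVT 1
    rw [show ⟪ξ, (1 : Op n) ξ⟫_ℂ = 1 from hone, one_smul] at this
    exact this
  · exact (hVT s).symm

theorem exists_eq_star_mul_self {H : Type v} [NormedAddCommGroup H] [InnerProductSpace ℂ H]
    [CompleteSpace H] {T : H →L[ℂ] H} (hT : 0 ≤ T) : ∃ S, T = star S * S :=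
  CStarAlgebra.nonneg_iff_eq_star_mul_self.1 hT

theorem exists_unit_level_one : ∃ ξ : Hilb ⟨1, le_rfl⟩, ‖ξ‖ = 1 :=
  ⟨lp.single 2 ⟨0, by simp⟩ 1, by rw [lp.norm_single (by norm_num)]; simp⟩

theorem mem_prism3Max_iff {n : Level} {a : Fin 2 → Op n} :
    a ∈ prism3Max n ↔ IsPrismPair (a 0) (a 1) := by
  constructor
  · rintro ⟨b, ⟨hb, hbK⟩, rfl⟩
    have key : ∀ ξ : Hilb n, ‖ξ‖ = 1 →
        ∃ p ∈ prism3, ∀ j, ⟪ξ, b j ξ⟫_ℂ = (p j : ℂ) := by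
      intro ξ hξ
      obtain ⟨φ, hφ, hval⟩ := exists_vectorState (opSysOf b) hξ
      have hmem : (fun j => ⟪ξ, b j ξ⟫_ℂ) ∈ rangeOne b := ⟨φ, hφ, fun j => (hval ⟨b j, mem_opSysOf b j⟩).symm⟩
      obtain ⟨p, hp, hpe⟩ := hbK hmem
      exact ⟨p, hp, fun j => (congrFun hpe j).symm⟩
    refine isPrismPair_of_unit fun ξ hξ => ?_
    obtain ⟨p, ⟨hp, hp'⟩, hpe⟩ := key ξ hξ
    constructor
    · have : ⟪ξ, toPair b 0 ξ⟫_ℂ = ⟨p 0, p 1⟩ := by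
        change ⟪ξ, b 0 ξ + Complex.I • b 1 ξ⟫_ℂ = _
        rw [inner_add_right, inner_smul_right, hpe, hpe, mul_comm, Complex.mk_eq_add_mul_I]
      rwa [this]
    · rwa [← hpe 2] at hp'
  · intro h
    have hx : (realPart (a 0) : Op n) + Complex.I • (imaginaryPart (a 0) : Op n) = a 0 :=
      realPart_add_I_smul_imaginaryPart (a 0)
    set b : Fin 3 → Op n := ![realPart (a 0), imaginaryPart (a 0), a 1] with hb
    have hx' : ContinuousLinearMap.adjoint (a 0) = b 0 - Complex.I • b 1 := by
      rw [← ContinuousLinearMap.star_eq_adjoint, ← hx, star_add, star_smul,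
        (realPart (a 0)).2.star_eq, (imaginaryPart (a 0)).2.star_eq, Complex.star_def,
        Complex.conj_I, neg_smul, ← sub_eq_add_neg]
      rfl
    refine ⟨b, ⟨fun j => ?_, ?_⟩, ?_⟩
    · fin_cases j
      exacts [(realPart (a 0)).2, (imaginaryPart (a 0)).2, (isPrismPair_iff_numRange.1 h).2.1]
    · rintro z ⟨φ, hφ, hz⟩
      obtain ⟨ξ, hξ⟩ := exists_unit_level_one
      have hone : ⟪ξ, ξ⟫_ℂ = 1 := by rw [inner_self_eq_norm_sq_to_K, hξ]; simp
      -- The positive functional `ψ` that corresponds to `φ`.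
      let ψ : (opSysOf b).toSubmodule → ℂ := fun s => ⟪ξ, φ s ξ⟫_ℂ
      have hadd : ∀ s t, ψ (s + t) = ψ s + ψ t := fun s t => by
        simp only [ψ, map_add, add_apply, inner_add_right]
      have hsmul : ∀ (c : ℂ) s, ψ (c • s) = c * ψ s := fun c s => by
        simp only [ψ, map_smul, smul_apply, inner_smul_right]
      have hunit : ψ (opSysOf b).unit = 1 := by
        simp only [ψ, hφ.map_unit]; exact hone
      have hψ : ∀ j, ψ ⟨b j, mem_opSysOf b j⟩ = z j := fun j => by
        simp only [ψ, ← hz j, smul_apply, inner_smul_right]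
        change z j * ⟪ξ, ξ⟫_ℂ = z j
        rw [hone, mul_one]
      have hpos : ∀ s : (opSysOf b).toSubmodule, (0 : Op n) ≤ s → 0 ≤ ψ s := fun s hs => by
        obtain ⟨c, hc⟩ := exists_eq_star_mul_self hs
        exact hφ.inner_nonneg hc ξ
      clear_value ψ
      let s : Fin 3 → (opSysOf b).toSubmodule := fun j => ⟨b j, mem_opSysOf b j⟩
      have hc : ∀ c : ℂ, c ^ 3 = 1 → 0 ≤ ((1 : ℝ) : ℂ) + c * (z 0 + Complex.I * z 1) +
          star c * (z 0 + (-Complex.I) * z 1) := by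
        intro c hc
        have := hpos ((opSysOf b).unit + c • (s 0 + Complex.I • s 1) +
          star c • (s 0 + (-Complex.I) • s 1)) (by
            have h1 := h.slack_nonneg hc
            rw [slack, hx', ← hx, sub_eq_add_neg, ← neg_smul] at h1
            exact h1)
        simpa only [hadd, hsmul, hunit, s, hψ, Complex.ofReal_one] using this
      have hpm : ∀ e : ℝ, |e| ≤ 1 → 0 ≤ 1 + (e : ℂ) * z 2 := by
        intro e he
        have := hpos ((opSysOf b).unit + (e : ℂ) • s 2) (h.one_add_smul_nonneg he)
        simpa only [hadd, hsmul, hunit, s, hψ] using this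
      obtain ⟨hq, hq'⟩ := eq_star_of_nonneg hc
      have h0 := congrArg Complex.re hq
      have h1 := congrArg Complex.im hq
      obtain ⟨h2, h2'⟩ := Complex.nonneg_iff.1 (hpm 1 (by norm_num))
      obtain ⟨h3, -⟩ := Complex.nonneg_iff.1 (hpm (-1) (by norm_num))
      simp at h0 h1 h2 h2' h3
      have hz0 : (z 0).im = 0 := by linarith
      have hz1 : (z 1).im = 0 := by linarith
      refine ⟨fun j => (z j).re, ⟨?_, ?_⟩, ?_⟩
      · have : (⟨(z 0).re, (z 1).re⟩ : ℂ) = z 0 + Complex.I * z 1 := by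
          apply Complex.ext <;> simp [hz0, hz1]
        rw [this]
        exact mem_convRoots_three.2 hq'
      · refine mem_convRoots_two.2 ⟨Complex.ofReal_im _, abs_le.2 ⟨?_, h3⟩⟩
        rw [Complex.ofReal_re]
        linarith
      · ext1 j
        apply Complex.ext
        · exact Complex.ofReal_re _
        · fin_cases j
          exacts [hz0.symm, hz1.symm, h2']
    · ext1 j
      fin_cases j
      · exact hx
      · rfl

/-! ### Direct sums of operators along a partition of unity -/

section DirectSum

open ContinuousLinearMap (adjoint)

variable {ι : Type} {m : ι → Level} {n : Level} {V : ∀ i, Hilb (m i) →ₗᵢ[ℂ] Hilb n}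

theorem hasSum_inner_compression {T : ∀ i, Op (m i)} {ξ η ζ : Hilb n}
    (h : HasSum (fun i => V i (T i (adjoint (V i).toContinuousLinearMap ξ))) ζ) :
    HasSum (fun i => ⟪adjoint (V i).toContinuousLinearMap η,
      T i (adjoint (V i).toContinuousLinearMap ξ)⟫_ℂ) ⟪η, ζ⟫_ℂ := by
  have := h.mapL (innerSL ℂ η)
  simp only [ContinuousLinearMap.adjoint_inner_left]
  exact this

theorem IsPartition.hasSum_norm_sq (hV : IsPartition V) (ξ : Hilb n) :
    HasSum (fun i => ‖adjoint (V i).toContinuousLinearMap ξ‖ ^ 2) (‖ξ‖ ^ 2) := by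
  have := Complex.hasSum_re (hasSum_inner_compression (T := fun i => 1) (η := ξ) (hV ξ))
  have hre : ∀ (k : Level) (ζ : Hilb k), (⟪ζ, ζ⟫_ℂ).re = ‖ζ‖ ^ 2 := fun k ζ => by
    rw [inner_self_eq_norm_sq_to_K]; norm_cast
  simpa only [one_apply_eq_self, hre] using this

/-- The isometries of a partition of unity have mutually orthogonal ranges. -/
theorem IsPartition.orthogonalFamily (hV : IsPartition V) :
    OrthogonalFamily ℂ (fun i => Hilb (m i)) V := by
  classical
  intro i k hik ζ η
  have h := sum_le_hasSum {k, i} (fun j _ => sq_nonneg _) (hV.hasSum_norm_sq (V k η))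
  rw [Finset.sum_pair hik.symm, adjoint_toContinuousLinearMap_apply, (V k).norm_map] at h
  have h0 : adjoint (V i).toContinuousLinearMap (V k η) = 0 := by
    rw [← norm_eq_zero, ← sq_eq_zero_iff]
    exact le_antisymm (by linarith) (sq_nonneg _)
  change ⟪(V i).toContinuousLinearMap ζ, V k η⟫_ℂ = 0
  rw [← ContinuousLinearMap.adjoint_inner_right, h0, inner_zero_right]

theorem IsPartition.exists_hasSum (hV : IsPartition V) (T : ∀ i, Op (m i)) {C : ℝ}
    (hC : ∀ i, ‖T i‖ ≤ C) :
    ∃ S : Op n, ∀ ξ,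
      HasSum (fun i => V i (T i (adjoint (V i).toContinuousLinearMap ξ))) (S ξ) := by
  have hle : ∀ ξ i, ‖T i (adjoint (V i).toContinuousLinearMap ξ)‖ ^ 2 ≤
      C ^ 2 * ‖adjoint (V i).toContinuousLinearMap ξ‖ ^ 2 := fun ξ i => by
    rw [← mul_pow]
    gcongr
    exact (T i).le_of_opNorm_le (hC i) _
  have hsum : ∀ ξ, Summable fun i => V i (T i (adjoint (V i).toContinuousLinearMap ξ)) :=
    fun ξ => by
      rw [hV.orthogonalFamily.summable_iff_norm_sq_summable]
      exact Summable.of_nonneg_of_le (fun i => sq_nonneg _) (hle ξ)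
        ((hV.hasSum_norm_sq ξ).summable.mul_left _)
  let S : Hilb n →ₗ[ℂ] Hilb n :=
    { toFun := fun ξ => ∑' i, V i (T i (adjoint (V i).toContinuousLinearMap ξ))
      map_add' := fun ξ η => by
        rw [← (hsum ξ).tsum_add (hsum η)]
        simp only [map_add]
      map_smul' := fun c ξ => by
        rw [RingHom.id_apply, ← (hsum ξ).tsum_const_smul c]
        simp only [map_smul] }
  refine ⟨S.mkContinuous |C| fun ξ => ?_, fun ξ => (hsum ξ).hasSum⟩
  rw [← abs_of_nonneg (norm_nonneg ξ), ← abs_mul, ← abs_of_nonneg (norm_nonneg (S ξ)), ← sq_le_sq]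
  refine le_of_tendsto ((hsum ξ).hasSum.norm.pow 2) (Filter.Eventually.of_forall fun s => ?_)
  rw [hV.orthogonalFamily.norm_sum, mul_pow]
  exact (Finset.sum_le_sum fun i _ => hle ξ i).trans
    (sum_le_hasSum s (fun i _ => by positivity) ((hV.hasSum_norm_sq ξ).mul_left _))

/-- Strong convergence of a direct sum of a bounded family of operators passes to the adjoints. -/
theorem IsPartition.hasSum_adjoint (hV : IsPartition V) {T : ∀ i, Op (m i)} {C : ℝ}
    (hC : ∀ i, ‖T i‖ ≤ C) {S : Op n}
    (hS : ∀ ξ, HasSum (fun i => V i (T i (adjoint (V i).toContinuousLinearMap ξ))) (S ξ))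
    (ξ : Hilb n) :
    HasSum (fun i => V i (adjoint (T i) (adjoint (V i).toContinuousLinearMap ξ)))
      (adjoint S ξ) := by
  obtain ⟨S', hS'⟩ := hV.exists_hasSum (fun i => adjoint (T i)) (C := C) fun i => by
    rw [LinearIsometryEquiv.norm_map]; exact hC i
  have : adjoint S = S' := by
    symm
    rw [ContinuousLinearMap.eq_adjoint_iff]
    intro ζ η
    have h1 := hasSum_inner_compression (η := ζ) (hS η)
    have h2 := Complex.hasSum_conj'.2 (hasSum_inner_compression (η := η) (hS' ζ))
    simp only [inner_conj_symm, ContinuousLinearMap.adjoint_inner_left (T _)] at h2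
    exact h2.unique h1
  rw [this]
  exact hS' ξ

end DirectSum

/-! ### Weak operator compactness -/

/-- Along an ultrafilter, every bounded family of operators converges in the weak operator
topology. -/
theorem exists_weak_limit {H : Type v} [NormedAddCommGroup H] [InnerProductSpace ℂ H]
    [CompleteSpace H] {X : Type w} (f : Ultrafilter X) (T : X → H →L[ℂ] H) {C : ℝ}
    (hC : ∀ t, ‖T t‖ ≤ C) :
    ∃ S : H →L[ℂ] H, ∀ ξ η,
      Filter.Tendsto (fun t => ⟪η, T t ξ⟫_ℂ) f (nhds ⟪η, S ξ⟫_ℂ) := by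
  have hbd : ∀ ξ η t, ‖⟪T t ξ, η⟫_ℂ‖ ≤ C * ‖ξ‖ * ‖η‖ := fun ξ η t =>
    (norm_inner_le_norm _ _).trans (by gcongr; exact (T t).le_of_opNorm_le (hC t) ξ)
  have hlim : ∀ ξ η, ∃ z : ℂ, ‖z‖ ≤ C * ‖ξ‖ * ‖η‖ ∧
      Filter.Tendsto (fun t => ⟪T t ξ, η⟫_ℂ) f (nhds z) := by
    intro ξ η
    obtain ⟨z, hz, hz'⟩ := (isCompact_closedBall (0 : ℂ) (C * ‖ξ‖ * ‖η‖)).ultrafilter_le_nhds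
      (f.map fun t => ⟪T t ξ, η⟫_ℂ) (Filter.tendsto_principal.2
        (Filter.Eventually.of_forall fun t => mem_closedBall_zero_iff.2 (hbd ξ η t)))
    exact ⟨z, mem_closedBall_zero_iff.1 hz, hz'⟩
  choose B hB hBlim using hlim
  let B' : H →ₗ⋆[ℂ] H →ₗ[ℂ] ℂ := LinearMap.mk₂'ₛₗ (starRingEnd ℂ) (RingHom.id ℂ) B
    (fun ξ ξ' η => tendsto_nhds_unique (hBlim _ _) (by
      simpa only [map_add, inner_add_left] using (hBlim ξ η).add (hBlim ξ' η)))
    (fun c ξ η => tendsto_nhds_unique (hBlim _ _) (by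
      simpa only [map_smul, inner_smul_left, smul_eq_mul] using (hBlim ξ η).const_mul (starRingEnd ℂ c)))
    (fun ξ η η' => tendsto_nhds_unique (hBlim _ _) (by
      simpa only [inner_add_right] using (hBlim ξ η).add (hBlim ξ η')))
    (fun c ξ η => tendsto_nhds_unique (hBlim _ _) (by
      simpa only [inner_smul_right, RingHom.id_apply, smul_eq_mul] using (hBlim ξ η).const_mul c))
  let B'' : H →L⋆[ℂ] H →L[ℂ] ℂ := B'.mkContinuous₂ C hB
  refine ⟨InnerProductSpace.continuousLinearMapOfBilin B'', fun ξ η => ?_⟩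
  have h1 : ⟪InnerProductSpace.continuousLinearMapOfBilin B'' ξ, η⟫_ℂ = B ξ η :=
    InnerProductSpace.continuousLinearMapOfBilin_apply _ _ _
  rw [← inner_conj_symm, h1]
  simpa only [Function.comp_def, inner_conj_symm] using
    (Complex.continuous_conj.tendsto _).comp (hBlim ξ η)

theorem IsPrismPair.of_tendsto {H : Type v} [NormedAddCommGroup H] [InnerProductSpace ℂ H]
    {X : Type w} {f : Filter X} [f.NeBot] {x y : X → H →L[ℂ] H} {x₀ y₀ : H →L[ℂ] H}
    (h : ∀ t, IsPrismPair (x t) (y t))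
    (hx : ∀ ξ, Filter.Tendsto (fun t => ⟪ξ, x t ξ⟫_ℂ) f (nhds ⟪ξ, x₀ ξ⟫_ℂ))
    (hy : ∀ ξ, Filter.Tendsto (fun t => ⟪ξ, y t ξ⟫_ℂ) f (nhds ⟪ξ, y₀ ξ⟫_ℂ)) :
    IsPrismPair x₀ y₀ := by
  intro ξ
  have hre := (Complex.continuous_re.tendsto _).comp (hy ξ)
  have him := (Complex.continuous_im.tendsto _).comp (hy ξ)
  refine ⟨fun c hc => ?_, ?_, ?_⟩
  · have := (((Complex.continuous_re.tendsto _).comp ((hx ξ).const_mul c)).const_mul 2).const_add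
      (‖ξ‖ ^ 2)
    exact ge_of_tendsto' this fun t => (h t ξ).1 c hc
  · exact tendsto_nhds_unique him (by
      simpa only [Function.comp_def, fun t => (h t ξ).2.1] using tendsto_const_nhds)
  · exact le_of_tendsto' hre.abs fun t => (h t ξ).2.2

theorem IsPrismPair.norm_le {H : Type v} [NormedAddCommGroup H] [InnerProductSpace ℂ H]
    [CompleteSpace H] {x y : H →L[ℂ] H} (h : IsPrismPair x y) : ‖x‖ ≤ 3 ∧ ‖y‖ ≤ 3 := by
  refine ⟨?_, (isPrismPair_iff_numRange.1 h).2.2.trans (by norm_num)⟩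
  have h1 := h.slack_nonneg (one_pow 3)
  have h2 := h.slack_nonneg omega_pow_three
  have h3 := h.slack_nonneg star_omega_pow_three
  have ha := omega_add_star
  have hm := omega_mul_star
  have hs := omega_mul_self
  have hs' : star omega * star omega = omega := by rw [← star_mul, hs, star_star]
  have hsum : slack 1 x + slack omega x + slack (star omega) x = (3 : ℂ) • (1 : H →L[ℂ] H) := by
    simp only [slack, star_star, star_one]
    match_scalars
    · norm_num
    · linear_combination ha
    · linear_combination ha
  have hx : (3 : ℂ) • x =
      slack 1 x + star omega • slack omega x + omega • slack (star omega) x := by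
    simp only [slack, star_star, star_one, smul_add, smul_smul]
    match_scalars
    · linear_combination -2 * hm
    · linear_combination -ha
    · linear_combination -(hs + hs' + ha)
  have hnorm : ‖(3 : ℂ) • (1 : H →L[ℂ] H)‖ ≤ 3 := by
    rw [norm_smul]
    calc ‖(3 : ℂ)‖ * ‖(1 : H →L[ℂ] H)‖ ≤ 3 * 1 := by
          gcongr
          · simp
          · exact ContinuousLinearMap.norm_id_le
      _ = 3 := by norm_num
  have n1 : ‖slack 1 x‖ ≤ 3 := (CStarAlgebra.norm_le_norm_of_nonneg_of_le h1 (by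
    rw [← hsum, add_assoc]; exact le_add_of_nonneg_right (add_nonneg h2 h3))).trans hnorm
  have n2 : ‖slack omega x‖ ≤ 3 := (CStarAlgebra.norm_le_norm_of_nonneg_of_le h2 (by
    rw [← hsum, add_comm (slack 1 x), add_assoc]
    exact le_add_of_nonneg_right (add_nonneg h1 h3))).trans hnorm
  have n3 : ‖slack (star omega) x‖ ≤ 3 := (CStarAlgebra.norm_le_norm_of_nonneg_of_le h3 (by
    rw [← hsum]; exact le_add_of_nonneg_left (add_nonneg h1 h2))).trans hnorm
  have hn : ‖omega‖ = 1 := Complex.norm_eq_one_of_pow_eq_one omega_pow_three (by norm_num)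
  have : ‖(3 : ℂ) • x‖ ≤ 9 := by
    rw [hx]
    refine (norm_add₃_le).trans ?_
    rw [norm_smul, norm_smul, norm_star, hn]
    linarith
  rw [norm_smul] at this
  norm_num at this
  linarith

/-! ### The range of the canonical unitaries as a compact noncommutative convex set -/

section Range

open ContinuousLinearMap (adjoint)

/-- The noncommutative numerical range `W_nc(w, v)` of the canonical unitaries. -/
abbrev prismRange : GradedSet (Fin 2) := ncRange ![canonW, canonV]

theorem norm_le_of_mem_prismRange {n : Level} {x : Fin 2 → Op n} (hx : x ∈ prismRange n)
    (j : Fin 2) : ‖x j‖ ≤ 3 := by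
  have := (mem_ncRange_iff.1 hx).norm_le
  fin_cases j
  exacts [this.1, this.2]

theorem IsPrismPair.of_isNCSum {ι : Type} {m : ι → Level} {n : Level}
    {V : ∀ i, Hilb (m i) →ₗᵢ[ℂ] Hilb n} (hV : IsPartition V) {x : ∀ i, Fin 2 → Op (m i)}
    (hx : ∀ i, IsPrismPair (x i 0) (x i 1)) {y : Fin 2 → Op n} (hy : IsNCSum V x y) :
    IsPrismPair (y 0) (y 1) := by
  intro ξ
  have hn := hV.hasSum_norm_sq ξ
  have h0 := hasSum_inner_compression (η := ξ) (hy 0 ξ)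
  have h1 := hasSum_inner_compression (η := ξ) (hy 1 ξ)
  have hre := Complex.hasSum_re h1
  have him := Complex.hasSum_im h1
  refine ⟨fun c hc => ?_, ?_, abs_le.2 ⟨?_, ?_⟩⟩
  · exact (hn.add ((Complex.hasSum_re (h0.mul_left c)).mul_left 2)).nonneg fun i => (hx i _).1 c hc
  · simp only [fun i => (hx i (adjoint (V i).toContinuousLinearMap ξ)).2.1] at him
    exact him.unique hasSum_zero
  · exact hasSum_le (fun i => (abs_le.1 (hx i _).2.2).1) hn.neg hre
  · exact hasSum_le (fun i => (abs_le.1 (hx i _).2.2).2) hre hn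

theorem IsPrismPair.compression {E : Type v} {H : Type w} [NormedAddCommGroup E]
    [InnerProductSpace ℂ E] [CompleteSpace E] [NormedAddCommGroup H] [InnerProductSpace ℂ H]
    [CompleteSpace H] {x y : H →L[ℂ] H} (h : IsPrismPair x y) (V : E →ₗᵢ[ℂ] H) :
    IsPrismPair (adjoint V.toContinuousLinearMap ∘L x ∘L V.toContinuousLinearMap)
      (adjoint V.toContinuousLinearMap ∘L y ∘L V.toContinuousLinearMap) := by
  intro ξ
  have hin : ∀ T : H →L[ℂ] H, ⟪ξ, (adjoint V.toContinuousLinearMap ∘L T ∘L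
      V.toContinuousLinearMap) ξ⟫_ℂ = ⟪V ξ, T (V ξ)⟫_ℂ := fun T => by
    rw [ContinuousLinearMap.comp_apply, ContinuousLinearMap.adjoint_inner_right]
    rfl
  rw [hin, hin, ← V.norm_map ξ]
  exact h (V ξ)

/-- The entries of a family are continuous functions in the weak operator topology. -/
theorem continuous_entry {J : Type u} (K : GradedSet J) (n : Level) (j : J) :
    @Continuous (K n) (Hilb n →WOT[ℂ] Hilb n) (levelTopology K n) inferInstance
      (fun p => ContinuousLinearMapWOT.ofCLM (p.1 j)) := by
  let := levelTopology K n
  have h : Continuous fun (p : K n) (j : J) =>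
      (ContinuousLinearMapWOT.ofCLM (p.1 j) : Hilb n →WOT[ℂ] Hilb n) := continuous_induced_dom
  exact (continuous_apply j).comp h

theorem compactSpace_prismRange (n : Level) :
    @CompactSpace (prismRange n) (levelTopology prismRange n) := by
  let := levelTopology prismRange n
  refine ⟨isCompact_iff_ultrafilter_le_nhds'.2 fun f _ => ?_⟩
  have hlim : ∀ j : Fin 2, ∃ S : Op n, ∀ ξ η : Hilb n,
      Filter.Tendsto (fun t : prismRange n => ⟪η, t.1 j ξ⟫_ℂ) f (nhds ⟪η, S ξ⟫_ℂ) := fun j =>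
    exists_weak_limit f (fun t : prismRange n => t.1 j) fun t => norm_le_of_mem_prismRange t.2 j
  choose S hS using hlim
  have hmem : S ∈ prismRange n := mem_ncRange_iff.2 <|
    IsPrismPair.of_tendsto (f := (f : Filter (prismRange n))) (fun t => mem_ncRange_iff.1 t.2)
      (fun ξ => hS 0 ξ ξ) (fun ξ => hS 1 ξ ξ)
  refine ⟨⟨S, hmem⟩, Set.mem_univ _, ?_⟩
  rw [nhds_induced, ← Filter.tendsto_iff_comap.trans Iff.rfl, tendsto_pi_nhds]
  intro j
  exact ContinuousLinearMapWOT.tendsto_iff_forall_inner_apply_tendsto.2 fun ξ η => hS j ξ η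

theorem isCompactNCConvex_prismRange : IsCompactNCConvex prismRange where
  directSum V x hV hx hC := by
    have hsum : ∀ j, ∃ S : Op _, ∀ ξ, HasSum
        (fun i => V i (x i j (adjoint (V i).toContinuousLinearMap ξ))) (S ξ) := fun j => by
      obtain ⟨C, hC⟩ := hC j
      exact hV.exists_hasSum _ hC
    choose y hy using hsum
    exact ⟨y, mem_ncRange_iff.2 (.of_isNCSum hV (fun i => mem_ncRange_iff.1 (hx i)) hy), hy⟩
  compression V x hx := mem_ncRange_iff.2 ((mem_ncRange_iff.1 hx).compression V)
  compact := compactSpace_prismRange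

/-- A uniformly bounded compact noncommutative convex set transports along levelwise bijections
that are continuous affine noncommutative maps. -/
theorem IsCompactNCConvex.of_equiv {J : Type u} {J' : Type v} {K : GradedSet J}
    {L : GradedSet J'} (hK : IsCompactNCConvex K)
    (hbd : ∀ j, ∃ C : ℝ, ∀ (n : Level), ∀ x ∈ K n, ‖x j‖ ≤ C) (θ : ∀ n, K n ≃ L n)
    (hθ : IsNCAffine fun n => θ n) : IsCompactNCConvex L where
  directSum {ι _ m n} V x hV hx _ := by
    have hb : ∀ j, ∃ C : ℝ, ∀ i, ‖((θ (m i)).symm ⟨x i, hx i⟩).1 j‖ ≤ C := fun j => by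
      obtain ⟨C, hC⟩ := hbd j
      exact ⟨C, fun i => hC _ _ (Subtype.property _)⟩
    obtain ⟨y, hy, hsum⟩ := hK.directSum V (fun i => ((θ (m i)).symm ⟨x i, hx i⟩).1) hV
      (fun i => Subtype.property _) hb
    refine ⟨(θ n ⟨y, hy⟩).1, Subtype.property _, ?_⟩
    have := hθ.map_directSum V (fun i => (θ (m i)).symm ⟨x i, hx i⟩) ⟨y, hy⟩ hV hb hsum
    simpa only [Equiv.apply_symm_apply] using this
  compression {m n} V x hx := by
    have := hθ.map_compression V ((θ m).symm ⟨x, hx⟩)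
      ⟨_, hK.compression V _ ((θ m).symm ⟨x, hx⟩).2⟩ rfl
    rw [Equiv.apply_symm_apply] at this
    exact this ▸ Subtype.property _
  compact n := by
    let := levelTopology K n
    let := levelTopology L n
    have := hK.compact n
    refine ⟨?_⟩
    rw [← (θ n).surjective.range_eq]
    exact isCompact_range (hθ.continuous n)

end Range

/-! ### The state space of the noncommutative prism -/

section StateSpace

open ContinuousLinearMap (adjoint)

/-- The canonical unitary of order three, as an element of `NCP(3)`. -/
def prismW : ncp3.toSubmodule := ⟨canonW, Submodule.subset_span (by simp)⟩

/-- The adjoint of the canonical unitary of order three, as an element of `NCP(3)`. -/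
def prismW2 : ncp3.toSubmodule := ⟨canonW ^ 2, Submodule.subset_span (by simp)⟩

/-- The canonical unitary of order two, as an element of `NCP(3)`. -/
def prismV : ncp3.toSubmodule := ⟨canonV, Submodule.subset_span (by simp)⟩

/-- A linear condition on the elements of `NCP(3)` holds if it holds for `1`, `w`, `w²`, `v`. -/
theorem ncp3_induction {P : ncp3.toSubmodule → Prop} (one : P ncp3.unit) (w : P prismW)
    (w2 : P prismW2) (v : P prismV) (add : ∀ s t, P s → P t → P (s + t))
    (smul : ∀ (c : ℂ) s, P s → P (c • s)) (s : ncp3.toSubmodule) : P s := by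
  obtain ⟨a, ha⟩ := s
  induction ha using Submodule.span_induction with
  | mem y hy => rcases hy with rfl | rfl | rfl | rfl <;> assumption
  | zero =>
    have := smul 0 _ one
    rwa [zero_smul] at this
  | add y z hy hz hPy hPz => exact add _ _ hPy hPz
  | smul c y hy hPy => exact smul c _ hPy

theorem exists_state {n : Level} {p : Fin 2 → Op n} (hp : p ∈ prismRange n) :
    ∃ φ : ncp3.toSubmodule →ₗ[ℂ] Op n, IsUCP ncp3 φ ∧ φ prismW = p 0 ∧ φ prismV = p 1 := by
  obtain ⟨φ, hφ, hw, hv⟩ := (mem_ncRange_iff.1 hp).exists_isUCP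
  exact ⟨_, hφ.restrict (S := ncp3) le_top, hw, hv⟩

/-- The ucp map on `NCP(3)` that sends `w` and `v` to the entries of a given pair. -/
def stateOf {n : Level} (p : prismRange n) : ncp3.toSubmodule →ₗ[ℂ] Op n :=
  (exists_state p.2).choose

section StateOf

variable {n : Level} (p : prismRange n)

theorem isUCP_stateOf : IsUCP ncp3 (stateOf p) := (exists_state p.2).choose_spec.1

theorem stateOf_unit : stateOf p ncp3.unit = 1 := (isUCP_stateOf p).map_unit

theorem stateOf_w : stateOf p prismW = p.1 0 := (exists_state p.2).choose_spec.2.1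

theorem stateOf_v : stateOf p prismV = p.1 1 := (exists_state p.2).choose_spec.2.2

theorem stateOf_w2 : stateOf p prismW2 = adjoint (p.1 0) := by
  rw [← stateOf_w]
  exact (isUCP_stateOf p).map_canonW_sq prismW.2 prismW2.2 prismV.2

end StateOf

/-- The bijection between pairs in the numerical range and ucp maps on `NCP(3)`. -/
def stateEquiv (n : Level) : prismRange n ≃ ncStateSpace ncp3 n where
  toFun p := ⟨stateOf p, stateOf p, isUCP_stateOf p, rfl⟩
  invFun f := ⟨![f.1 prismW, f.1 prismV], by
    obtain ⟨φ, hφ, hf⟩ := f.2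
    rw [mem_ncRange_iff, hf]
    exact (hφ.isPrismPair_canon prismW.2 prismW2.2 prismV.2).1⟩
  left_inv p := by
    apply Subtype.ext
    funext j
    fin_cases j
    exacts [stateOf_w p, stateOf_v p]
  right_inv f := by
    obtain ⟨f, φ, hφ, rfl⟩ := f
    apply Subtype.ext
    funext s
    change stateOf _ s = φ s
    induction s using ncp3_induction with
    | one => rw [stateOf_unit, hφ.map_unit]
    | w => exact stateOf_w _
    | w2 =>
      rw [stateOf_w2]
      exact (hφ.map_canonW_sq prismW.2 prismW2.2 prismV.2).symm
    | v => exact stateOf_v _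
    | add s t hs ht => rw [map_add, map_add, hs, ht]
    | smul c s hs => rw [map_smul, map_smul, hs]

theorem stateEquiv_apply {n : Level} (p : prismRange n) (s : ncp3.toSubmodule) :
    (stateEquiv n p).1 s = stateOf p s := rfl

theorem isNCAffine_stateEquiv : IsNCAffine fun n => stateEquiv n where
  map_directSum V x y hV hC hsum := by
    intro s ξ
    simp only [stateEquiv_apply]
    induction s using ncp3_induction with
    | one => simpa only [stateOf_unit] using! hV ξ
    | w => simpa only [stateOf_w] using hsum 0 ξ
    | w2 =>
      obtain ⟨C, hC⟩ := hC 0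
      simpa only [stateOf_w2] using hV.hasSum_adjoint hC (hsum 0) ξ
    | v => simpa only [stateOf_v] using hsum 1 ξ
    | add s t hs ht => simpa only [map_add, add_apply] using hs.add ht
    | smul c s hs => simpa only [map_smul, smul_apply] using hs.const_smul c
  map_compression V x y h := by
    funext s
    simp only [stateEquiv_apply, compress]
    induction s using ncp3_induction with
    | one =>
      rw [stateOf_unit, stateOf_unit]
      ext1 ξ
      exact (adjoint_toContinuousLinearMap_apply V ξ).symm
    | w => rw [stateOf_w, stateOf_w, h, compress]
    | w2 =>
      rw [stateOf_w2, stateOf_w2, h, compress, ContinuousLinearMap.adjoint_comp,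
        ContinuousLinearMap.adjoint_comp, ContinuousLinearMap.adjoint_adjoint]
      rfl
    | v => rw [stateOf_v, stateOf_v, h, compress]
    | add s t hs ht =>
      rw [map_add, map_add, hs, ht, ContinuousLinearMap.add_comp, ContinuousLinearMap.comp_add]
    | smul c s hs =>
      rw [map_smul, map_smul, hs, ContinuousLinearMap.smul_comp, ContinuousLinearMap.comp_smul]
  continuous n := by
    let := levelTopology prismRange n
    refine continuous_induced_rng.2 (continuous_pi fun s => ?_)
    change Continuous fun p : prismRange n =>
      (ContinuousLinearMapWOT.ofCLM (stateOf p s) : Hilb n →WOT[ℂ] Hilb n)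
    have hcoord := continuous_entry prismRange n
    induction s using ncp3_induction with
    | one => simpa only [stateOf_unit] using continuous_const
    | w => simpa only [stateOf_w] using hcoord 0
    | w2 =>
      simp only [stateOf_w2]
      exact continuous_star.comp (hcoord 0)
    | v => simpa only [stateOf_v] using hcoord 1
    | add s t hs ht =>
      simp only [map_add, ContinuousLinearMapWOT.ofCLM_add]
      exact hs.add ht
    | smul c s hs =>
      simp only [map_smul, ContinuousLinearMapWOT.ofCLM_smul]
      exact hs.const_smul c

theorem isNCAffine_stateEquiv_symm : IsNCAffine fun n => (stateEquiv n).symm where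
  map_directSum V x y hV hC hsum := by
    intro j ξ
    fin_cases j
    exacts [hsum prismW ξ, hsum prismV ξ]
  map_compression V x y h := by
    funext j
    fin_cases j
    exacts [congrFun h prismW, congrFun h prismV]
  continuous n := by
    let := levelTopology (ncStateSpace ncp3) n
    refine continuous_induced_rng.2 (continuous_pi fun j => ?_)
    fin_cases j
    exacts [continuous_entry _ n prismW, continuous_entry _ n prismV]

theorem ncConvIso_prismRange : NCConvIso prismRange (ncStateSpace ncp3) :=
  ⟨isCompactNCConvex_prismRange,
    isCompactNCConvex_prismRange.of_equiv
      (fun j => ⟨3, fun _ _ hx => norm_le_of_mem_prismRange hx j⟩) stateEquiv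
      isNCAffine_stateEquiv,
    stateEquiv, isNCAffine_stateEquiv, isNCAffine_stateEquiv_symm⟩

end StateSpace

end NCPrism

end

theorem theorem4p1 :
    (∀ n : NCPrism.Level,
      NCPrism.prism3Max n = NCPrism.ncRange ![NCPrism.canonW, NCPrism.canonV] n) ∧
    NCPrism.NCConvIso (NCPrism.ncRange ![NCPrism.canonW, NCPrism.canonV])
      (NCPrism.ncStateSpace NCPrism.ncp3) ∧
    (∀ (H : Type*) [NormedAddCommGroup H] [InnerProductSpace ℂ H] [CompleteSpace H]
      (x y : H →L[ℂ] H),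
      (NCPrism.numRange x ⊆ NCPrism.convRoots 3 ∧ IsSelfAdjoint y ∧ ‖y‖ ≤ 1) ↔
      ∃ φ : (NCPrism.OperatorSystem.whole
          (NCPrism.GroupCStar NCPrism.FreeProd32)).toSubmodule →ₗ[ℂ] (H →L[ℂ] H),
        NCPrism.IsUCP (NCPrism.OperatorSystem.whole
          (NCPrism.GroupCStar NCPrism.FreeProd32)) φ ∧
        φ ⟨NCPrism.canonW, Submodule.mem_top⟩ = x ∧
        φ ⟨NCPrism.canonV, Submodule.mem_top⟩ = y) := by
  refine ⟨fun n => Set.ext fun a => ?_, NCPrism.ncConvIso_prismRange, fun H _ _ _ x y => ?_⟩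
  · rw [NCPrism.mem_prism3Max_iff, NCPrism.mem_ncRange_iff]
  · rw [← NCPrism.isPrismPair_iff_numRange]
    refine ⟨fun h => h.exists_isUCP, ?_⟩
    rintro ⟨φ, hφ, rfl, rfl⟩
    exact (hφ.isPrismPair_canon Submodule.mem_top Submodule.mem_top Submodule.mem_top).1
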